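/- Let $M$ be a Kähler manifold of real dimension $2m$, i.e. a complex manifold of complex dimension $m$, with complex structure tensor $J$, and a smooth Riemannian metric $g$ such that $g(Jv,Jw)=g(v,w)$ and $\nabla J=0$, where $\nabla$ is the Levi-Civita connection of $g$. Smooth real local coordinates $(x_1,\dots,x_{2m})$ are called orthogonal if $g(\partial/\partial x_i,\partial/\partial x_j)=0$ for $i\ne j$; one then sets $a_i=\sqrt{g(\partial/\partial x_i,\partial/\partial x_i)}>0$ and $e_i=\frac1{a_i}\frac{\partial}{\partial x_i}$. They are called unitary if in addition $Je_{2k+1}=e_{2k+2}$ and $Je_{2k+2}=-e_{2k+1}$ for $k=0,\dots,m-1$. (1) In any orthogonal coordinates on an open subset of $M$ that are unitary, for each $k$ the coefficients $a_{2k+1}$ and $a_{2k+2}$ depend only on $(x_{2k+1},x_{2k+2})$, in the following sense: on every convex subset of the coordinate domain in $\mathbb{R}^{2m}$ they take equal values at any two points with the same $x_{2k+1}$ and $x_{2k+2}$ (in particular this holds near every point). (2) If every point of $M$ has a neighborhood with orthogonal coordinates that are unitary, then $M$ is locally a Riemannian product of Riemann surfaces: every point of $M$ has an open neighborhood $U$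 for which there are Riemann surfaces $S_1,\dots,S_m$ with smooth Riemannian metrics $g_1,\dots,g_m$ compatible with their complex structures, and a diffeomorphism $\Phi=(\Phi_1,\dots,\Phi_m):U\to S_1\times\cdots\times S_m$ with each $\Phi_k$ holomorphic, such that $g=\sum_{k=1}^m\Phi_k^*g_k$ on $U$. -/

import Mathlib

open scoped Manifold ContDiff Bundle Topology

noncomputable section

namespace KahlerOrthogonal

section ComplexManifold

variable {E : Type*} [NormedAddCommGroup E] [NormedSpace ℂ E]

/-- A complex manifold (charts in the complex vector space `E`, holomorphic transition maps) is in
particular a real manifold, with the same charts and of every order of smoothness. -/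
instance isManifold_real {M : Type*} [TopologicalSpace M] [ChartedSpace E M]
    [h : IsManifold 𝓘(ℂ, E) ω M] (n : ℕ∞ω) : IsManifold 𝓘(ℝ, E) n M := by
  have : IsManifold 𝓘(ℝ, E) ω M := by
    apply isManifold_of_contDiffOn
    intro e e' he he'
    have h1 := (contDiffGroupoid ω 𝓘(ℂ, E)).compatible he he'
    rw [contDiffGroupoid, mem_groupoid_of_pregroupoid] at h1
    exact ContDiffOn.restrict_scalars ℝ (h1.1 : ContDiffOn ℂ ω _ _)
  exact IsManifold.of_le (m := n) (n := ω) le_top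

/-- The complex structure tensor `J` of a complex manifold: multiplication by `i` on each (real)
tangent space. Mathlib identifies the tangent space at `x` with `E` through the preferred
holomorphic chart at `x`; as transition maps are holomorphic, any other holomorphic chart gives the
same endomorphism. -/
def complexJ {M : Type*} [TopologicalSpace M] [ChartedSpace E M] (x : M) :
    TangentSpace 𝓘(ℝ, E) x →L[ℝ] TangentSpace 𝓘(ℝ, E) x :=
  (Complex.I • ContinuousLinearMap.id ℝ E : E →L[ℝ] E)

variable (E) in
/-- Smooth Riemannian metrics on (the real manifold underlying) a complex manifold. -/
abbrev SmoothMetric (M : Type*) [TopologicalSpace M] [ChartedSpace E M]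
    [IsManifold 𝓘(ℂ, E) ω M] :=
  Bundle.ContMDiffRiemannianMetric 𝓘(ℝ, E) ∞ E (fun x : M => TangentSpace 𝓘(ℝ, E) x)

variable {M : Type*} [TopologicalSpace M] [ChartedSpace E M] [IsManifold 𝓘(ℂ, E) ω M]

/-- `J` acts by isometries on each tangent space. -/
def IsHermitian (g : SmoothMetric E M) : Prop :=
  ∀ (x : M) (v w : TangentSpace 𝓘(ℝ, E) x),
    g.inner x (complexJ x v) (complexJ x w) = g.inner x v w

/-- The vector field `Y` is differentiable at `x`. -/
def VFDiffAt (Y : Π x : M, TangentSpace 𝓘(ℝ, E) x) (x : M) : Prop :=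
  MDifferentiableAt 𝓘(ℝ, E) 𝓘(ℝ, E).tangent
    (fun y => (⟨y, Y y⟩ : TangentBundle 𝓘(ℝ, E) M)) x

/-- `D` is the Levi-Civita connection of `g`: it is metric,
`v ⟨Y, Z⟩ = ⟨∇_v Y, Z⟩ + ⟨Y, ∇_v Z⟩`, and torsion-free.
Here `D Y x v` is the covariant derivative of the vector field `Y` in the direction `v ∈ T_x M`. -/
structure IsLeviCivita [FiniteDimensional ℂ E] (g : SmoothMetric E M)
    (D : CovariantDerivative 𝓘(ℝ, E) E (fun x : M => TangentSpace 𝓘(ℝ, E) x)) : Prop where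
  metric : ∀ (Y Z : Π x : M, TangentSpace 𝓘(ℝ, E) x) (x : M), VFDiffAt Y x → VFDiffAt Z x →
    ∀ v : TangentSpace 𝓘(ℝ, E) x,
      mvfderiv 𝓘(ℝ, E) (fun y => g.inner y (Y y) (Z y)) x v
        = g.inner x (D Y x v) (Z x) + g.inner x (Y x) (D Z x v)
  torsion_free : D.torsion = 0

/-- `g` is a Kähler metric: it is Hermitian, and `J` is parallel for the Levi-Civita connection,
`∇_v (J Y) = J (∇_v Y)`. -/
structure IsKahler [FiniteDimensional ℂ E] (g : SmoothMetric E M) : Prop where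
  hermitian : IsHermitian g
  parallel : ∃ D : CovariantDerivative 𝓘(ℝ, E) E (fun x : M => TangentSpace 𝓘(ℝ, E) x),
    IsLeviCivita g D ∧
      ∀ (Y : Π x : M, TangentSpace 𝓘(ℝ, E) x) (x : M), VFDiffAt Y x →
        ∀ v : TangentSpace 𝓘(ℝ, E) x,
          D (fun y => complexJ y (Y y)) x v = complexJ x (D Y x v)

/-! ### Orthogonal coordinates -/

/-- The coordinate space `ℝⁿ`. -/
abbrev Coord (n : ℕ) := EuclideanSpace ℝ (Fin n)

/-- `φ` is a smooth real coordinate chart of `M`, on the open set `φ.source`. -/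
structure IsSmoothChart {n : ℕ} (φ : OpenPartialHomeomorph M (Coord n)) : Prop where
  smooth : ContMDiffOn 𝓘(ℝ, E) 𝓘(ℝ, Coord n) ∞ φ φ.source
  smooth_symm : ContMDiffOn 𝓘(ℝ, Coord n) 𝓘(ℝ, E) ∞ φ.symm φ.target

variable (E) in
/-- The coordinate vector field `∂/∂x_i` of the chart `φ`, at the point with coordinates `y`. -/
def coordField {n : ℕ} (φ : OpenPartialHomeomorph M (Coord n)) (i : Fin n) (y : Coord n) :
    TangentSpace 𝓘(ℝ, E) (φ.symm y) :=
  mfderiv 𝓘(ℝ, Coord n) 𝓘(ℝ, E) φ.symm y (EuclideanSpace.single i (1 : ℝ) : Coord n)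

/-- The coordinates of the chart `φ` are orthogonal. -/
structure IsOrthogonalChart {n : ℕ} (g : SmoothMetric E M)
    (φ : OpenPartialHomeomorph M (Coord n)) : Prop where
  isSmoothChart : IsSmoothChart (E := E) φ
  orthogonal : ∀ y ∈ φ.target, ∀ i j : Fin n, i ≠ j →
    g.inner (φ.symm y) (coordField E φ i y) (coordField E φ j y) = 0

/-- The coefficient `a_i = √⟨∂/∂x_i, ∂/∂x_i⟩`, as a function of the coordinates. -/
def coeff {n : ℕ} (g : SmoothMetric E M) (φ : OpenPartialHomeomorph M (Coord n)) (i : Fin n)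
    (y : Coord n) : ℝ :=
  √(g.inner (φ.symm y) (coordField E φ i y) (coordField E φ i y))

/-- The associated frame `e_i = (1 / a_i) ∂/∂x_i`, at the point with coordinates `y`. -/
def frame {n : ℕ} (g : SmoothMetric E M) (φ : OpenPartialHomeomorph M (Coord n)) (i : Fin n)
    (y : Coord n) : TangentSpace 𝓘(ℝ, E) (φ.symm y) :=
  (coeff g φ i y)⁻¹ • coordField E φ i y

/-- The first index of the `k`-th pair (`2k+1` when indices start from `1`). -/
def fstIdx {m : ℕ} (k : Fin m) : Fin (2 * m) := ⟨2 * k, by omega⟩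

/-- The second index of the `k`-th pair (`2k+2` when indices start from `1`). -/
def sndIdx {m : ℕ} (k : Fin m) : Fin (2 * m) := ⟨2 * k + 1, by omega⟩

/-- The coordinates of the chart `φ` are orthogonal, and their associated frame is unitary:
`J e_{2k+1} = e_{2k+2}` and `J e_{2k+2} = - e_{2k+1}`. -/
structure IsUnitaryOrthogonalChart {m : ℕ} (g : SmoothMetric E M)
    (φ : OpenPartialHomeomorph M (Coord (2 * m))) : Prop where
  isOrthogonalChart : IsOrthogonalChart g φ
  map_fst : ∀ y ∈ φ.target, ∀ k : Fin m,
    complexJ (φ.symm y) (frame g φ (fstIdx k) y) = frame g φ (sndIdx k) y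
  map_snd : ∀ y ∈ φ.target, ∀ k : Fin m,
    complexJ (φ.symm y) (frame g φ (sndIdx k) y) = -frame g φ (fstIdx k) y

/-- Every point of `M` has a neighborhood with unitary orthogonal coordinates. -/
def SupportsUnitaryOrthogonalCoordinates (m : ℕ) (g : SmoothMetric E M) : Prop :=
  ∀ p : M, ∃ φ : OpenPartialHomeomorph M (Coord (2 * m)),
    p ∈ φ.source ∧ IsUnitaryOrthogonalChart g φ

/-- On every convex part of the coordinate domain of `φ`, the function `f` depends only on the
`k`-th pair of coordinates. (As balls are convex, this is so around every point of the domain.) -/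
def DependsOnlyOnPair {m : ℕ} (φ : OpenPartialHomeomorph M (Coord (2 * m))) (k : Fin m)
    (f : Coord (2 * m) → ℝ) : Prop :=
  ∀ V : Set (Coord (2 * m)), Convex ℝ V → V ⊆ φ.target → ∀ y ∈ V, ∀ z ∈ V,
    y (fstIdx k) = z (fstIdx k) → y (sndIdx k) = z (sndIdx k) → f y = f z

end ComplexManifold

/-! ### Products of Riemann surfaces -/

/-- A Riemann surface (connected Hausdorff complex manifold of complex dimension one) with a smooth
Riemannian metric compatible with its complex structure. -/
structure MetricRiemannSurface where
  carrier : Type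
  [topologicalSpace : TopologicalSpace carrier]
  [t2Space : T2Space carrier]
  [connectedSpace : ConnectedSpace carrier]
  [chartedSpace : ChartedSpace ℂ carrier]
  [isManifold : IsManifold 𝓘(ℂ, ℂ) ω carrier]
  metric : SmoothMetric ℂ carrier
  hermitian : IsHermitian metric

attribute [instance] MetricRiemannSurface.topologicalSpace MetricRiemannSurface.t2Space
  MetricRiemannSurface.connectedSpace MetricRiemannSurface.chartedSpace
  MetricRiemannSurface.isManifold

section Product

variable {E : Type*} [NormedAddCommGroup E] [NormedSpace ℂ E]
  {M : Type*} [TopologicalSpace M] [ChartedSpace E M] [IsManifold 𝓘(ℂ, E) ω M]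

/-- `Φ` identifies the open set `Φ.source` of `M` with the whole Riemannian product of the Riemann
surfaces `S k`: it is a homeomorphism onto the product, its components `Φ_k` are holomorphic (complex
differentiable, hence smooth), and `g` is the product metric, `g = ∑ k, Φ_k^* g_k`. As `g` is
positive definite, `Φ` is then a diffeomorphism onto the product. -/
structure IsProductIsometry {m : ℕ} (g : SmoothMetric E M) (S : Fin m → MetricRiemannSurface)
    (Φ : OpenPartialHomeomorph M (Π k, (S k).carrier)) : Prop where
  target_eq : Φ.target = Set.univ
  holomorphic : ∀ k, MDifferentiableOn 𝓘(ℂ, E) 𝓘(ℂ, ℂ) (fun q => Φ q k) Φ.source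
  isometry : ∀ q ∈ Φ.source, ∀ v w : TangentSpace 𝓘(ℝ, E) q,
    g.inner q v w = ∑ k, (S k).metric.inner (Φ q k)
      (mfderiv 𝓘(ℝ, E) 𝓘(ℝ, ℂ) (fun q' => Φ q' k) q v)
      (mfderiv 𝓘(ℝ, E) 𝓘(ℝ, ℂ) (fun q' => Φ q' k) q w)

/-- `M` is locally a Riemannian product of `m` Riemann surfaces. -/
def IsLocallyProductOfRiemannSurfaces (m : ℕ) (g : SmoothMetric E M) : Prop :=
  ∀ p : M, ∃ (S : Fin m → MetricRiemannSurface)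
    (Φ : OpenPartialHomeomorph M (Π k, (S k).carrier)), p ∈ Φ.source ∧ IsProductIsometry g S Φ

end Product

end KahlerOrthogonal

end

/-!
In orthogonal coordinates, the vector fields `∂_i` commute and are orthogonal, so `⟨∇_i ∂_j, ∂_l⟩`
vanishes for distinct `i`, `j`, `l`. The field `J ∂_j` is a multiple of the partner `∂_{j'}`, and
`∇_i (J ∂_j) = J ∇_i ∂_j`; paired with `∂_i`, this gives `∂_{j'} ‖∂_i‖² = 0` whenever `i` and `j`
belong to different pairs. So the coefficient `a_i` depends only on the pair of `i`.

Hence the form `θ_k = a_{2k+1} dx_{2k+1} + i a_{2k+2} dx_{2k+2}` lives on the `k`-th coordinate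
plane. Unitarity says that it is of type `(1, 0)`, and `g = ∑ |θ_k|²`. The restriction of a
suitable holomorphic function on `M` to the `k`-th coordinate plane is therefore a function `W` with
`dW = κ θ_k` and `κ ≠ 0`, that is, an isothermal coordinate. A disc in its image, with the metric
`|κ|⁻² |dz|²`, is the `k`-th factor.
-/

noncomputable section

namespace KahlerOrthogonal

section ConformalSurface

variable {U : TopologicalSpace.Opens ℂ} {a : ℂ → ℝ}

theorem symmL_trivializationAt_opens {𝕜 F : Type*} [NontriviallyNormedField 𝕜]
    [NormedAddCommGroup F] [NormedSpace 𝕜 F] {U : TopologicalSpace.Opens F} (x z : U) (v : F) :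
    (trivializationAt F (TangentSpace 𝓘(𝕜, F)) x).symmL 𝕜 z v = v := by
  have hz : z ∈ (chartAt F x).source := mem_chart_source F z
  exact (congrArg (fun L : F →L[𝕜] F => L v)
    (TangentBundle.symmL_trivializationAt_eq_core (I := 𝓘(𝕜, F)) hz)).trans <|
    (tangentBundleCore 𝓘(𝕜, F) U).coordChange_self (achart F z) z (mem_achart_source F z) v

theorem isVonNBounded_mul_inner_self_lt_one {F : Type*} [NormedAddCommGroup F]
    [InnerProductSpace ℝ F] {a : ℝ} (ha : 0 < a) :
    Bornology.IsVonNBounded ℝ {v : F | a * inner ℝ v v < 1} := by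
  refine (NormedSpace.isVonNBounded_ball ℝ F (√a⁻¹)).subset fun v (hv : a * inner ℝ v v < 1) => ?_
  rw [mem_ball_zero_iff]
  apply Real.lt_sqrt_of_sq_lt
  rwa [← real_inner_self_eq_norm_sq, inv_eq_one_div, lt_div_iff₀' ha]

/-- The inner product `a |dz|²` on the tangent spaces of a plane domain. -/
def conformalInner (a : ℂ → ℝ) (z : U) :
    TangentSpace 𝓘(ℝ, ℂ) z →L[ℝ] TangentSpace 𝓘(ℝ, ℂ) z →L[ℝ] ℝ :=
  (a z • innerSL ℝ : ℂ →L[ℝ] ℂ →L[ℝ] ℝ)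

theorem contMDiff_conformalInner (ha : ContDiffOn ℝ ∞ a U) :
    ContMDiff 𝓘(ℝ, ℂ) (𝓘(ℝ, ℂ).prod 𝓘(ℝ, ℂ →L[ℝ] ℂ →L[ℝ] ℝ)) ∞
      (fun z : U => Bundle.TotalSpace.mk' (ℂ →L[ℝ] ℂ →L[ℝ] ℝ)
        (E := fun z : U => TangentSpace 𝓘(ℝ, ℂ) z →L[ℝ] TangentSpace 𝓘(ℝ, ℂ) z →L[ℝ] ℝ)
        z (conformalInner a z)) := by
  intro z
  rw [Bundle.contMDiffAt_section]
  have a_smooth : ContMDiffAt 𝓘(ℝ, ℂ) 𝓘(ℝ, ℝ) ∞ (fun w : U => a w) z :=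
    (ha.contDiffAt (U.isOpen.mem_nhds z.2)).contMDiffAt.comp z contMDiff_subtype_val.contMDiffAt
  let euclidean : ℂ →L[ℝ] ℂ →L[ℝ] ℝ := innerSL ℝ
  have form_smooth : ContMDiffAt 𝓘(ℝ, ℂ) 𝓘(ℝ, ℂ →L[ℝ] ℂ →L[ℝ] ℝ) ∞
      (fun w : U => a w • euclidean) z :=
    a_smooth.smul (contMDiffAt_const (c := euclidean))
  refine form_smooth.congr_of_eventuallyEq (Filter.Eventually.of_forall fun w => ?_)
  have hw : w ∈ (chartAt ℂ z).source := mem_chart_source ℂ w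
  ext v v'
  simp only [hom_trivializationAt_apply, ContinuousLinearMap.inCoordinates,
    ContinuousLinearMap.comp_apply, Bundle.Trivialization.continuousLinearMapAt_apply,
    hom_trivializationAt_baseSet, TangentBundle.trivializationAt_baseSet,
    Bundle.Trivial.fiberBundle_trivializationAt', Bundle.Trivial.trivialization_baseSet,
    Set.inter_univ, hw, Bundle.Trivialization.coe_linearMapAt_of_mem,
    Bundle.Trivial.continuousLinearMapAt_trivialization, ContinuousLinearMap.id_comp, smul_apply]
  exact congrArg₂ (fun v v' : ℂ => a w * inner ℝ v v') (symmL_trivializationAt_opens (𝕜 := ℝ) z w v)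
    (symmL_trivializationAt_opens (𝕜 := ℝ) z w v')

/-- The conformal metric `a |dz|²` on a plane domain. -/
def conformalMetric (a : ℂ → ℝ) (ha : ContDiffOn ℝ ∞ a U) (hpos : ∀ z ∈ U, 0 < a z) :
    SmoothMetric ℂ U where
  inner := conformalInner a
  symm z v w := congrArg (a z * ·) (real_inner_comm (F := ℂ) w v)
  pos z v hv := mul_pos (hpos z z.2) ((real_inner_self_pos (F := ℂ) (x := v)).2 hv)
  isVonNBounded z := isVonNBounded_mul_inner_self_lt_one (F := ℂ) (hpos z z.2)
  contMDiff := contMDiff_conformalInner ha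

theorem inner_mul_mul (c v w : ℂ) :
    inner ℝ (c * v) (c * w) = ‖c‖ ^ 2 * inner ℝ v w := by
  simp only [Complex.inner, map_mul, Complex.sq_norm, Complex.normSq_apply, Complex.mul_re,
    Complex.mul_im, Complex.conj_re, Complex.conj_im]
  ring

/-- A connected plane domain with the conformal metric `a |dz|²`, as a Riemann surface. -/
def conformalSurface (hU : IsConnected (U : Set ℂ)) (a : ℂ → ℝ) (ha : ContDiffOn ℝ ∞ a U)
    (hpos : ∀ z ∈ U, 0 < a z) : MetricRiemannSurface where
  carrier := U
  connectedSpace := isConnected_iff_connectedSpace.1 hU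
  metric := conformalMetric a ha hpos
  hermitian z v w := congrArg (a z * ·) <| (inner_mul_mul Complex.I v w).trans <| by
    rw [Complex.norm_I, one_pow, one_mul]
    rfl

end ConformalSurface

section ComplexDifferentiability

variable {E F : Type*} [NormedAddCommGroup E] [NormedSpace ℂ E]
  [NormedAddCommGroup F] [NormedSpace ℂ F]
  {M : Type*} [TopologicalSpace M] [ChartedSpace E M]
  {N : Type*} [TopologicalSpace N] [ChartedSpace F N] {f : M → N} {x : M}

theorem complexJ_complexJ (x : M) (v : TangentSpace 𝓘(ℝ, E) x) :
    complexJ x (complexJ x v) = -v := by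
  have I_smul_I_smul (w : E) : Complex.I • Complex.I • w = -w := by
    rw [smul_smul, Complex.I_mul_I, neg_one_smul]
  exact I_smul_I_smul v

theorem hasMFDerivAt_real_of_complex {f' : E →L[ℂ] F}
    (hf : HasMFDerivAt 𝓘(ℂ, E) 𝓘(ℂ, F) f x f') :
    HasMFDerivAt 𝓘(ℝ, E) 𝓘(ℝ, F) f x (f'.restrictScalars ℝ) :=
  ⟨hf.1, hf.2.restrictScalars ℝ⟩

theorem mfderiv_complexJ (hf : MDifferentiableAt 𝓘(ℂ, E) 𝓘(ℂ, F) f x)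
    (v : TangentSpace 𝓘(ℝ, E) x) :
    mfderiv 𝓘(ℝ, E) 𝓘(ℝ, F) f x (complexJ x v) =
      complexJ (f x) (mfderiv 𝓘(ℝ, E) 𝓘(ℝ, F) f x v) := by
  let f' : E →L[ℂ] F := mfderiv 𝓘(ℂ, E) 𝓘(ℂ, F) f x
  rw [(hasMFDerivAt_real_of_complex (f' := f') hf.hasMFDerivAt).mfderiv]
  exact f'.map_smul Complex.I v

theorem exists_restrictScalars_eq_of_map_I_smul (L : E →L[ℝ] F)
    (hL : ∀ v, L (Complex.I • v) = Complex.I • L v) :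
    ∃ L' : E →L[ℂ] F, L'.restrictScalars ℝ = L := by
  refine ⟨⟨⟨L.toAddHom, fun z v => ?_⟩, L.cont⟩, rfl⟩
  change L (z • v) = z • L v
  rw [← Complex.re_add_im z, add_smul, add_smul, map_add, mul_smul, mul_smul]
  simp only [Complex.coe_smul, map_smul, hL]

theorem mdifferentiableAt_complex_of_map_I_smul {f' : E →L[ℝ] F}
    (hf : HasMFDerivAt 𝓘(ℝ, E) 𝓘(ℝ, F) f x f')
    (hf' : ∀ v, f' (Complex.I • v) = Complex.I • f' v) :
    MDifferentiableAt 𝓘(ℂ, E) 𝓘(ℂ, F) f x := by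
  obtain ⟨L, rfl⟩ := exists_restrictScalars_eq_of_map_I_smul f' hf'
  refine HasMFDerivAt.mdifferentiableAt (f' := L) ⟨hf.1, ?_⟩
  have real_deriv := hf.2
  simp only [mfld_simps] at real_deriv ⊢
  exact (hasFDerivAt_of_restrictScalars ℝ
    (hasFDerivWithinAt_univ.1 real_deriv) rfl).hasFDerivWithinAt

theorem hasMFDerivAt_subtypeVal_comp_iff {𝕜 E F : Type*} [NontriviallyNormedField 𝕜]
    [NormedAddCommGroup E] [NormedSpace 𝕜 E] [NormedAddCommGroup F] [NormedSpace 𝕜 F]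
    {M : Type*} [TopologicalSpace M] [ChartedSpace E M]
    {U : TopologicalSpace.Opens F} {f : M → U} {x : M} {f' : E →L[𝕜] F} :
    HasMFDerivAt 𝓘(𝕜, E) 𝓘(𝕜, F) (fun q => (f q : F)) x f' ↔
      HasMFDerivAt 𝓘(𝕜, E) 𝓘(𝕜, F) f x f' :=
  and_congr_left' Topology.IsInducing.subtypeVal.continuousAt_iff.symm

end ComplexDifferentiability

theorem eq_of_fderiv_sub_eq_zero {V F : Type*} [NormedAddCommGroup V] [NormedSpace ℝ V]
    [NormedAddCommGroup F] [NormedSpace ℝ F] {f : V → F} {y z : V}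
    (hf : ∀ x ∈ segment ℝ y z, DifferentiableAt ℝ f x)
    (hf' : ∀ x ∈ segment ℝ y z, fderiv ℝ f x (z - y) = 0) : f y = f z := by
  have hasDeriv : ∀ t ∈ Set.Icc (0 : ℝ) 1,
      HasDerivAt (fun t : ℝ => f (AffineMap.lineMap y z t)) 0 t := by
    intro t ht
    have mem : AffineMap.lineMap y z t ∈ segment ℝ y z :=
      segment_eq_image_lineMap ℝ y z ▸ Set.mem_image_of_mem _ ht
    simpa only [hf' _ mem, Function.comp_def] using
      (hf _ mem).hasFDerivAt.comp_hasDerivAt t AffineMap.hasDerivAt_lineMap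
  have const := constant_of_has_deriv_right_zero
    (fun t ht => (hasDeriv t ht).continuousAt.continuousWithinAt)
    (fun t ht => (hasDeriv t (Set.Ico_subset_Icc_self ht)).hasDerivWithinAt)
  simpa using (const 1 (Set.right_mem_Icc.2 zero_le_one)).symm

section Isothermal

theorem exists_openPartialHomeomorph_target_eq_ball {V : Type*} [NormedAddCommGroup V]
    [NormedSpace ℝ V] [CompleteSpace V] {f : V → V} {O : Set V} {n : ℕ∞ω} (hn : n ≠ 0)
    (hO : IsOpen O) (hf : ContDiffOn ℝ n f O)
    (hf' : ∀ x ∈ O, (fderiv ℝ f x).IsInvertible) {x₀ : V} (hx₀ : x₀ ∈ O) :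
    ∃ (e : OpenPartialHomeomorph V V) (r : ℝ), 0 < r ∧ ⇑e = f ∧ x₀ ∈ e.source ∧ e.source ⊆ O ∧
      e.target = Metric.ball (f x₀) r ∧ ContDiffOn ℝ n e.symm e.target := by
  have smoothAt : ∀ x ∈ O, ContDiffAt ℝ n f x := fun x hx => hf.contDiffAt (hO.mem_nhds hx)
  choose! A hA using hf'
  have hasFDerivAt : ∀ x ∈ O, HasFDerivAt f (A x : V →L[ℝ] V) x := fun x hx => by
    rw [hA x hx]
    exact ((smoothAt x hx).differentiableAt hn).hasFDerivAt
  let e₀ := (smoothAt x₀ hx₀).toOpenPartialHomeomorph f (hasFDerivAt x₀ hx₀) hn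
  let e₁ := e₀.restrOpen O hO
  have hx₀e : x₀ ∈ e₁.source :=
    ⟨(smoothAt x₀ hx₀).mem_toOpenPartialHomeomorph_source (hasFDerivAt x₀ hx₀) hn, hx₀⟩
  obtain ⟨r, hr, ball_subset⟩ := Metric.isOpen_iff.1 e₁.open_target (f x₀) (e₁.map_source hx₀e)
  let e := (e₁.symm.restrOpen _ (Metric.isOpen_ball (x := f x₀) (ε := r))).symm
  have target_eq : e.target = Metric.ball (f x₀) r := Set.inter_eq_right.2 ball_subset
  refine ⟨e, r, hr, rfl, ?_, ?_, target_eq, fun w hw => ?_⟩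
  · exact ⟨hx₀e, Metric.mem_ball_self hr⟩
  · exact fun x hx => hx.1.2
  · have hw' : w ∈ e₁.target := hw.1
    have mem : e₁.symm w ∈ O := (e₁.map_target hw').2
    exact (e₁.contDiffAt_symm hw' (hasFDerivAt _ mem) (smoothAt _ mem)).contDiffWithinAt

/-- The real linear map `x + i y ↦ α x + i β y`. It is the value of the coframe `α dx + i β dy`. -/
def axisScale (α β : ℝ) : ℂ →L[ℝ] ℂ :=
  α • Complex.reCLM.smulRight (1 : ℂ) + β • Complex.imCLM.smulRight Complex.I

theorem axisScale_apply (α β : ℝ) (v : ℂ) : axisScale α β v = ⟨α * v.re, β * v.im⟩ := by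
  apply Complex.ext <;> simp [axisScale]

theorem axisScale_one (α β : ℝ) : axisScale α β 1 = α := by
  simp [axisScale]

theorem axisScale_I (α β : ℝ) : axisScale α β Complex.I = β * Complex.I := by
  simp [axisScale]

theorem axisScale_ne_zero {α β : ℝ} (hα : α ≠ 0) : axisScale α β ≠ 0 := by
  intro h
  have := axisScale_one α β
  rw [h] at this
  exact hα (Complex.ofReal_eq_zero.1 this.symm)

theorem axisScale_axisScale_inv {α β : ℝ} (hα : α ≠ 0) (hβ : β ≠ 0) (w : ℂ) :
    axisScale α β (axisScale α⁻¹ β⁻¹ w) = w := by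
  simp [axisScale_apply, hα, hβ]

theorem isInvertible_smul_axisScale {c : ℂ} {α β : ℝ} (hc : c ≠ 0) (hα : α ≠ 0) (hβ : β ≠ 0) :
    (c • axisScale α β).IsInvertible := by
  refine .of_inverse (g := axisScale α⁻¹ β⁻¹ ∘L ContinuousLinearMap.mul ℝ ℂ c⁻¹)
    (ContinuousLinearMap.ext fun w => ?_) (ContinuousLinearMap.ext fun v => ?_)
  · simp [axisScale_axisScale_inv hα hβ, hc]
  · simp [axisScale_apply, hα, hβ, hc]

/-- The map `e` identifies its domain, with the metric `α² dx² + β² dy²`, with the whole Riemann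
surface `S`, so that `e` is an isothermal coordinate: its differential is a complex multiple of the
coframe `α dx + i β dy`. -/
structure IsIsothermalParametrization (S : MetricRiemannSurface)
    (e : OpenPartialHomeomorph ℂ S.carrier) (α β : ℂ → ℝ) : Prop where
  target_eq : e.target = Set.univ
  exists_hasMFDerivAt : ∀ u ∈ e.source, ∃ c : ℂ,
    HasMFDerivAt 𝓘(ℝ, ℂ) 𝓘(ℝ, ℂ) e u (c • axisScale (α u) (β u)) ∧
      ∀ z w : ℂ, S.metric.inner (e u) (c * z : ℂ) (c * w : ℂ) = inner ℝ z w

theorem exists_isIsothermalParametrization_of_diffeo {W : OpenPartialHomeomorph ℂ ℂ}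
    {α β : ℂ → ℝ} {κ : ℂ → ℂ} (hκ : ContDiffOn ℝ ∞ κ W.source)
    (hκ0 : ∀ u ∈ W.source, κ u ≠ 0)
    (hW : ∀ u ∈ W.source, HasFDerivAt W (κ u • axisScale (α u) (β u)) u)
    (hWsymm : ContDiffOn ℝ ∞ W.symm W.target) (hconn : IsConnected W.target) :
    ∃ (S : MetricRiemannSurface) (e : OpenPartialHomeomorph ℂ S.carrier),
      e.source = W.source ∧ IsIsothermalParametrization S e α β := by
  let U : TopologicalSpace.Opens ℂ := ⟨W.target, W.open_target⟩
  have : Nonempty U := hconn.nonempty.to_subtype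
  let a : ℂ → ℝ := fun w => (‖κ (W.symm w)‖ ^ 2)⁻¹
  have ha : ContDiffOn ℝ ∞ a U := ((hκ.comp hWsymm W.mapsTo_symm).norm_sq ℝ).inv
    fun w hw => pow_ne_zero 2 (norm_ne_zero_iff.2 (hκ0 _ (W.map_target hw)))
  have hpos : ∀ w ∈ U, 0 < a w := fun w hw =>
    inv_pos.2 (pow_pos (norm_pos_iff.2 (hκ0 _ (W.map_target hw))) 2)
  let incl : OpenPartialHomeomorph U ℂ := U.openPartialHomeomorphSubtypeCoe ‹_›
  let e : OpenPartialHomeomorph ℂ U := W.trans incl.symm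
  have incl_target : incl.target = W.target := U.openPartialHomeomorphSubtypeCoe_target ‹_›
  have source_eq : e.source = W.source := by
    rw [W.trans_source, incl.symm_source, incl_target]
    exact Set.inter_eq_left.2 W.mapsTo
  have coe_e : Set.EqOn (fun u => (e u : ℂ)) W W.source := fun u hu =>
    incl.right_inv (incl_target ▸ W.map_source hu)
  refine ⟨conformalSurface hconn a ha hpos, e, source_eq, ?_, fun u hu => ⟨κ u, ?_, fun z w => ?_⟩⟩
  · refine Set.eq_univ_of_forall fun w => ⟨Set.mem_univ w, ?_⟩
    exact w.2
  · rw [source_eq] at hu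
    exact hasMFDerivAt_subtypeVal_comp_iff.1 <| (hW u hu).hasMFDerivAt.congr_of_eventuallyEq
      (coe_e.eventuallyEq_of_mem (W.open_source.mem_nhds hu))
  · rw [source_eq] at hu
    change a (e u : ℂ) * inner ℝ (κ u * z) (κ u * w) = _
    have hκu : ‖κ u‖ ^ 2 ≠ 0 := pow_ne_zero 2 (norm_ne_zero_iff.2 (hκ0 u hu))
    have a_eq : a (e u : ℂ) = (‖κ u‖ ^ 2)⁻¹ := by
      simp only [a, show (e u : ℂ) = W u from coe_e hu, W.left_inv hu]
    rw [inner_mul_mul, a_eq, inv_mul_cancel_left₀ hκu]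

theorem exists_isIsothermalParametrization {W : ℂ → ℂ} {O : Set ℂ} {α β : ℂ → ℝ} (hO : IsOpen O)
    (hW : ContDiffOn ℝ ∞ W O) (hα : ContDiffOn ℝ ∞ α O) (hα0 : ∀ u ∈ O, α u ≠ 0)
    (hβ0 : ∀ u ∈ O, β u ≠ 0)
    (hW' : ∀ u ∈ O, ∃ c : ℂ, fderiv ℝ W u = c • axisScale (α u) (β u))
    {u₀ : ℂ} (hu₀ : u₀ ∈ O) (hWu₀ : fderiv ℝ W u₀ ≠ 0) :
    ∃ (S : MetricRiemannSurface) (e : OpenPartialHomeomorph ℂ S.carrier),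
      u₀ ∈ e.source ∧ e.source ⊆ O ∧ IsIsothermalParametrization S e α β := by
  let κ : ℂ → ℂ := fun u => (α u)⁻¹ • fderiv ℝ W u 1
  have fderiv_eq : ∀ u ∈ O, fderiv ℝ W u = κ u • axisScale (α u) (β u) := by
    intro u hu
    obtain ⟨c, hc⟩ := hW' u hu
    have κ_eq : κ u = c := by
      have := Complex.ofReal_ne_zero.2 (hα0 u hu)
      simp only [κ, hc, smul_apply, axisScale_one, smul_eq_mul, Complex.real_smul,
        Complex.ofReal_inv]
      field_simp
    rw [κ_eq, hc]
  have hκ : ContDiffOn ℝ ∞ κ O := (hα.inv hα0).smul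
    ((hW.fderiv_of_isOpen hO (m := ∞) (by simp)).clm_apply contDiffOn_const)
  let O' := O ∩ κ ⁻¹' {0}ᶜ
  have hO' : IsOpen O' := hκ.continuousOn.isOpen_inter_preimage hO isOpen_compl_singleton
  have hu₀' : u₀ ∈ O' := ⟨hu₀, fun κ_eq : κ u₀ = 0 => hWu₀ <| by
    rw [fderiv_eq u₀ hu₀, κ_eq]
    exact zero_smul ℂ (axisScale (α u₀) (β u₀))⟩
  obtain ⟨e₀, r, hr, rfl, hu₀e, source_subset, target_eq, symm_smooth⟩ :=
    exists_openPartialHomeomorph_target_eq_ball (by simp) hO' (hW.mono Set.inter_subset_left)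
      (fun u hu => fderiv_eq u hu.1 ▸
        isInvertible_smul_axisScale hu.2 (hα0 u hu.1) (hβ0 u hu.1)) hu₀'
  have source_subset_O := source_subset.trans Set.inter_subset_left
  have hasFDerivAt : ∀ u ∈ e₀.source, HasFDerivAt e₀ (κ u • axisScale (α u) (β u)) u := by
    intro u hu
    rw [← fderiv_eq u (source_subset_O hu)]
    exact ((hW.contDiffAt (hO.mem_nhds (source_subset_O hu))).differentiableAt
      (by simp)).hasFDerivAt
  obtain ⟨S, e, source_eq, he⟩ := exists_isIsothermalParametrization_of_diffeo
    (hκ.mono source_subset_O) (fun u hu => (source_subset hu).2)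
    hasFDerivAt symm_smooth (target_eq ▸ Metric.isConnected_ball hr)
  exact ⟨S, e, source_eq ▸ hu₀e, source_eq ▸ source_subset_O, he⟩

end Isothermal

section LeviCivita

variable {E : Type*} [NormedAddCommGroup E] [NormedSpace ℂ E]
  {M : Type*} [TopologicalSpace M] [ChartedSpace E M] [IsManifold 𝓘(ℂ, E) ω M]
  {g : SmoothMetric E M} {x : M}

/-- The vector fields `X i` behave at `x` like the coordinate fields of orthogonal coordinates:
they are differentiable and commute at `x`, and are pairwise orthogonal around `x`. -/
structure IsCommutingOrthogonalFamilyAt {ι : Type*} (g : SmoothMetric E M)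
    (X : ι → Π x : M, TangentSpace 𝓘(ℝ, E) x) (x : M) : Prop where
  vfDiffAt : ∀ i, VFDiffAt (X i) x
  mlieBracket_eq_zero : ∀ i j, VectorField.mlieBracket 𝓘(ℝ, E) (X i) (X j) x = 0
  orthogonal : ∀ i j, i ≠ j → ∀ᶠ q in 𝓝 x, g.inner q (X i q) (X j q) = 0

theorem IsHermitian.inner_complexJ_left (hg : IsHermitian g) (v w : TangentSpace 𝓘(ℝ, E) x) :
    g.inner x (complexJ x v) w = -g.inner x v (complexJ x w) := by
  rw [← hg x v (complexJ x w), complexJ_complexJ, map_neg, neg_neg]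

variable [FiniteDimensional ℂ E]
  {D : CovariantDerivative 𝓘(ℝ, E) E (fun x : M => TangentSpace 𝓘(ℝ, E) x)}
  {X Y : Π x : M, TangentSpace 𝓘(ℝ, E) x}

theorem IsLeviCivita.apply_comm (hD : IsLeviCivita g D) (hX : VFDiffAt X x) (hY : VFDiffAt Y x)
    (hXY : VectorField.mlieBracket 𝓘(ℝ, E) X Y x = 0) : D Y x (X x) = D X x (Y x) := by
  have := (CovariantDerivative.torsion_eq_zero_iff D).1 hD.torsion_free hX hY
  rwa [hXY, sub_eq_zero] at this

theorem IsLeviCivita.inner_apply_eq_neg (hD : IsLeviCivita g D) (hX : VFDiffAt X x)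
    (hY : VFDiffAt Y x) (hXY : ∀ᶠ q in 𝓝 x, g.inner q (X q) (Y q) = 0)
    (v : TangentSpace 𝓘(ℝ, E) x) :
    g.inner x (D X x v) (Y x) = -g.inner x (X x) (D Y x v) := by
  have hconst : (fun q => g.inner q (X q) (Y q)) =ᶠ[𝓝 x] fun _ => (0 : ℝ) := hXY
  have hderiv : mvfderiv 𝓘(ℝ, E) (fun q => g.inner q (X q) (Y q)) x = 0 :=
    (hconst.mfderiv_eq (I := 𝓘(ℝ, E)) (I' := 𝓘(ℝ, ℝ))).trans mfderiv_const
  rw [eq_neg_iff_add_eq_zero, ← hD.metric X Y x hX hY v, hderiv]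
  rfl

variable {ι : Type*} {X : ι → Π x : M, TangentSpace 𝓘(ℝ, E) x}

-- `⟨∇_i X_j, X_l⟩` is symmetric in `i, j` and skew in `j, l`.
theorem IsLeviCivita.inner_apply_eq_zero (hD : IsLeviCivita g D)
    (hX : IsCommutingOrthogonalFamilyAt g X x) {i j l : ι} (hij : i ≠ j) (hjl : j ≠ l)
    (hil : i ≠ l) : g.inner x (D (X j) x (X i x)) (X l x) = 0 := by
  have comm (i j : ι) : D (X j) x (X i x) = D (X i) x (X j x) :=
    hD.apply_comm (hX.vfDiffAt i) (hX.vfDiffAt j) (hX.mlieBracket_eq_zero i j)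
  have skew {i j : ι} (hij : i ≠ j) (v : TangentSpace 𝓘(ℝ, E) x) :
      g.inner x (D (X i) x v) (X j x) = -g.inner x (D (X j) x v) (X i x) := by
    rw [hD.inner_apply_eq_neg (hX.vfDiffAt i) (hX.vfDiffAt j) (hX.orthogonal i j hij), g.symm]
  have hjl' := skew hjl (X i x)
  have hli' := skew hil.symm (X j x)
  have hij' := skew hij (X l x)
  rw [comm i l] at hjl'
  rw [comm j l, comm j i] at hli'
  linarith

theorem IsKahler.mvfderiv_inner_self_eq_zero (hg : IsKahler g)
    (hX : IsCommutingOrthogonalFamilyAt g X x) {i i' j j' : ι} (hii' : i ≠ i') (hij : i ≠ j)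
    (hij' : i ≠ j') (hi'j : i' ≠ j) {σ : M → ℝ} (hσ : MDifferentiableAt 𝓘(ℝ, E) 𝓘(ℝ, ℝ) σ x)
    (hσ0 : σ x ≠ 0) (hj : ∀ᶠ q in 𝓝 x, complexJ q (X j q) = σ q • X j' q) {τ : ℝ}
    (hi : complexJ x (X i x) = τ • X i' x) :
    mvfderiv 𝓘(ℝ, E) (fun q => g.inner q (X i q) (X i q)) x (X j' x) = 0 := by
  obtain ⟨D, hD, hJ⟩ := hg.parallel
  have smul_diff : VFDiffAt (σ • X j') x := hσ.smul_section (hX.vfDiffAt j')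
  have J_diff : VFDiffAt (fun q => complexJ q (X j q)) x :=
    smul_diff.congr_of_eventuallyEq <|
      hj.mono fun q hq => congrArg (Bundle.TotalSpace.mk q) hq
  have parallel : complexJ x (D (X j) x (X i x)) =
      σ x • D (X j') x (X i x) + mvfderiv 𝓘(ℝ, E) σ x (X i x) • X j' x := by
    rw [← hJ (X j) x (hX.vfDiffAt j),
      D.isCovariantDerivativeOnUniv.congr_of_eventuallyEq J_diff smul_diff Filter.univ_mem hj,
      D.isCovariantDerivativeOnUniv.leibniz (hX.vfDiffAt j') hσ]
    rfl
  have inner_apply_j' : g.inner x (D (X j') x (X i x)) (X i x) = 0 := by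
    have hinner := congrArg (fun v => g.inner x v (X i x)) parallel
    simp only [hg.hermitian.inner_complexJ_left, hi, map_smul, map_add, add_apply, smul_apply,
      hD.inner_apply_eq_zero hX hij hi'j.symm hii', (hX.orthogonal j' i hij'.symm).self_of_nhds,
      smul_eq_mul, mul_zero, neg_zero, add_zero] at hinner
    exact (mul_eq_zero.1 hinner.symm).resolve_left hσ0
  rw [hD.metric _ _ x (hX.vfDiffAt i) (hX.vfDiffAt i), g.symm x (X i x),
    hD.apply_comm (hX.vfDiffAt j') (hX.vfDiffAt i) (hX.mlieBracket_eq_zero j' i), inner_apply_j',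
    add_zero]

end LeviCivita

section CoordinateFields

variable {E : Type*} [NormedAddCommGroup E] [NormedSpace ℂ E]
  {M : Type*} [TopologicalSpace M] [ChartedSpace E M]
  {n : ℕ} {φ : OpenPartialHomeomorph M (Coord n)}

/-- The constant vector field in the `i`-th coordinate direction. -/
def constField (n : ℕ) (i : Fin n) (y : Coord n) : TangentSpace 𝓘(ℝ, Coord n) y :=
  (EuclideanSpace.single i (1 : ℝ) : Coord n)

theorem contMDiff_constField (n : ℕ) (i : Fin n) (k : ℕ∞ω) :
    ContMDiff 𝓘(ℝ, Coord n) 𝓘(ℝ, Coord n).tangent k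
      (fun y => (⟨y, constField n i y⟩ : TangentBundle 𝓘(ℝ, Coord n) (Coord n))) :=
  contMDiff_vectorSpace_iff_contDiff.2 contDiff_const

theorem mlieBracket_constField (i j : Fin n) (y : Coord n) :
    VectorField.mlieBracket 𝓘(ℝ, Coord n) (constField n i) (constField n j) y = 0 := by
  have lieBracket_const (v w : Coord n) :
      VectorField.lieBracketWithin ℝ (fun _ : Coord n => v) (fun _ => w) Set.univ y = 0 := by
    simp [VectorField.lieBracketWithin]
  rw [← VectorField.mlieBracketWithin_univ, VectorField.mlieBracketWithin_eq_lieBracketWithin]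
  exact lieBracket_const _ _

variable (E) in
/-- The coordinate vector field `∂/∂x_i` of the chart `φ`, as a vector field on `M`. It is
meaningful on `φ.source` only. -/
def chartField (φ : OpenPartialHomeomorph M (Coord n)) (i : Fin n) :
    Π x : M, TangentSpace 𝓘(ℝ, E) x :=
  VectorField.mpullback 𝓘(ℝ, E) 𝓘(ℝ, Coord n) φ (constField n i)

theorem IsSmoothChart.mdifferentiable (hφ : IsSmoothChart (E := E) φ) :
    φ.MDifferentiable 𝓘(ℝ, E) 𝓘(ℝ, Coord n) :=
  ⟨hφ.smooth.mdifferentiableOn (by simp), hφ.smooth_symm.mdifferentiableOn (by simp)⟩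

theorem IsSmoothChart.mfderiv_symm_mfderiv (hφ : IsSmoothChart (E := E) φ) {y : Coord n}
    (hy : y ∈ φ.target) (v : TangentSpace 𝓘(ℝ, E) (φ.symm y)) :
    mfderiv 𝓘(ℝ, Coord n) 𝓘(ℝ, E) φ.symm y
      (mfderiv 𝓘(ℝ, E) 𝓘(ℝ, Coord n) φ (φ.symm y) v) = v := by
  have := hφ.mdifferentiable.symm_comp_deriv (φ.map_target hy)
  rw [φ.right_inv hy] at this
  exact DFunLike.congr_fun this v

theorem IsSmoothChart.mfderiv_coordField (hφ : IsSmoothChart (E := E) φ) (i : Fin n)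
    {y : Coord n} (hy : y ∈ φ.target) :
    mfderiv 𝓘(ℝ, E) 𝓘(ℝ, Coord n) φ (φ.symm y) (coordField E φ i y) =
      (EuclideanSpace.single i (1 : ℝ) : Coord n) :=
  DFunLike.congr_fun (hφ.mdifferentiable.comp_symm_deriv hy) _

theorem coordField_ne_zero (hφ : IsSmoothChart (E := E) φ) (i : Fin n) {y : Coord n}
    (hy : y ∈ φ.target) : coordField E φ i y ≠ 0 := by
  intro h0
  have := hφ.mfderiv_coordField i hy
  rw [h0, map_zero] at this
  exact one_ne_zero ((PiLp.single_eq_zero_iff 2 i).1 this.symm)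

theorem chartField_symm (hφ : IsSmoothChart (E := E) φ) (i : Fin n) {y : Coord n}
    (hy : y ∈ φ.target) : chartField E φ i (φ.symm y) = coordField E φ i y := by
  have inverse_eq : (mfderiv 𝓘(ℝ, E) 𝓘(ℝ, Coord n) φ (φ.symm y)).inverse =
      mfderiv 𝓘(ℝ, Coord n) 𝓘(ℝ, E) φ.symm y :=
    ContinuousLinearMap.inverse_eq (hφ.mdifferentiable.comp_symm_deriv hy)
      (ContinuousLinearMap.ext (hφ.mfderiv_symm_mfderiv hy))
  rw [chartField, VectorField.mpullback_apply, inverse_eq]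
  rfl

variable [IsManifold 𝓘(ℂ, E) ω M] {g : SmoothMetric E M} {x : M}

theorem contMDiffAt_inner {X Y : Π x : M, TangentSpace 𝓘(ℝ, E) x}
    (hX : ContMDiffAt 𝓘(ℝ, E) 𝓘(ℝ, E).tangent ∞
      (fun q => (⟨q, X q⟩ : TangentBundle 𝓘(ℝ, E) M)) x)
    (hY : ContMDiffAt 𝓘(ℝ, E) 𝓘(ℝ, E).tangent ∞
      (fun q => (⟨q, Y q⟩ : TangentBundle 𝓘(ℝ, E) M)) x) :
    ContMDiffAt 𝓘(ℝ, E) 𝓘(ℝ, ℝ) ∞ (fun q => g.inner q (X q) (Y q)) x := by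
  let _ : Bundle.RiemannianBundle (fun x : M => TangentSpace 𝓘(ℝ, E) x) := ⟨g.toRiemannianMetric⟩
  exact ContMDiffAt.inner_bundle (IB := 𝓘(ℝ, E)) (F := E) (v := X) (w := Y) hX hY

/-- The squared length of the coordinate field `∂/∂x_i`, as a function of the coordinates. -/
def sqCoeff (g : SmoothMetric E M) (φ : OpenPartialHomeomorph M (Coord n)) (i : Fin n)
    (y : Coord n) : ℝ :=
  g.inner (φ.symm y) (coordField E φ i y) (coordField E φ i y)

theorem sqCoeff_pos (hφ : IsSmoothChart (E := E) φ) (i : Fin n) {y : Coord n}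
    (hy : y ∈ φ.target) : 0 < sqCoeff g φ i y :=
  g.pos _ _ (coordField_ne_zero hφ i hy)

theorem coeff_ne_zero (hφ : IsSmoothChart (E := E) φ) (i : Fin n) {y : Coord n}
    (hy : y ∈ φ.target) : coeff g φ i y ≠ 0 :=
  (Real.sqrt_pos.2 (sqCoeff_pos hφ i hy)).ne'

theorem coeff_smul_frame (hφ : IsSmoothChart (E := E) φ) (i : Fin n)
    {y : Coord n} (hy : y ∈ φ.target) : coeff g φ i y • frame g φ i y = coordField E φ i y :=
  smul_inv_smul₀ (coeff_ne_zero hφ i hy) _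

theorem ext_frame (hφ : IsSmoothChart (E := E) φ) {y : Coord n} (hy : y ∈ φ.target)
    {F : Type*} [AddCommGroup F] [Module ℝ F] [TopologicalSpace F]
    {L L' : TangentSpace 𝓘(ℝ, E) (φ.symm y) →L[ℝ] F}
    (h : ∀ i, L (frame g φ i y) = L' (frame g φ i y)) : L = L' := by
  have comp_eq : L ∘L mfderiv 𝓘(ℝ, Coord n) 𝓘(ℝ, E) φ.symm y =
      L' ∘L mfderiv 𝓘(ℝ, Coord n) 𝓘(ℝ, E) φ.symm y := by
    refine ContinuousLinearMap.coe_injective <|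
      (EuclideanSpace.basisFun (Fin n) ℝ).toBasis.ext fun i => ?_
    rw [OrthonormalBasis.coe_toBasis, EuclideanSpace.basisFun_apply]
    change L (coordField E φ i y) = L' (coordField E φ i y)
    rw [← coeff_smul_frame (g := g) hφ i hy, map_smul, map_smul, h i]
  ext v
  rw [← hφ.mfderiv_symm_mfderiv hy v]
  exact DFunLike.congr_fun comp_eq _

theorem IsOrthogonalChart.inner_frame (h : IsOrthogonalChart g φ) (i j : Fin n) {y : Coord n}
    (hy : y ∈ φ.target) :
    g.inner (φ.symm y) (frame g φ i y) (frame g φ j y) = if i = j then 1 else 0 := by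
  simp only [frame, map_smul, smul_apply, smul_eq_mul]
  split_ifs with hij
  · subst hij
    have sq : g.inner (φ.symm y) (coordField E φ i y) (coordField E φ i y) = coeff g φ i y ^ 2 :=
      (Real.sq_sqrt (sqCoeff_pos h.isSmoothChart i hy).le).symm
    have := coeff_ne_zero (g := g) h.isSmoothChart i hy
    rw [sq]
    field_simp
  · rw [h.orthogonal y hy i j hij, mul_zero, mul_zero]

theorem eqOn_sqCoeff (hφ : IsSmoothChart (E := E) φ) (i : Fin n) :
    Set.EqOn (sqCoeff g φ i)
      ((fun q => g.inner q (chartField E φ i q) (chartField E φ i q)) ∘ φ.symm) φ.target := by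
  intro y hy
  rw [Function.comp_apply, chartField_symm hφ i hy]
  rfl

variable [CompleteSpace E]

theorem contMDiffAt_chartField (hφ : IsSmoothChart (E := E) φ) (i : Fin n)
    (hx : x ∈ φ.source) :
    ContMDiffAt 𝓘(ℝ, E) 𝓘(ℝ, E).tangent ∞
      (fun q => (⟨q, chartField E φ i q⟩ : TangentBundle 𝓘(ℝ, E) M)) x :=
  ContMDiffAt.mpullback_vectorField_preimage (I := 𝓘(ℝ, E)) (I' := 𝓘(ℝ, Coord n)) (m := ∞)
    (n := ∞) (contMDiff_constField n i ∞ (φ x))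
    (hφ.smooth.contMDiffAt (φ.open_source.mem_nhds hx)) ⟨hφ.mdifferentiable.mfderiv hx, rfl⟩ le_rfl

theorem mlieBracket_chartField (hφ : IsSmoothChart (E := E) φ) (i j : Fin n)
    (hx : x ∈ φ.source) :
    VectorField.mlieBracket 𝓘(ℝ, E) (chartField E φ i) (chartField E φ j) x = 0 := by
  have constField_diff (i : Fin n) :=
    (contMDiff_constField n i 1).mdifferentiable one_ne_zero (φ x)
  rw [chartField, chartField, ← VectorField.mpullback_mlieBracket (n := ∞) (constField_diff i)
    (constField_diff j) (hφ.smooth.contMDiffAt (φ.open_source.mem_nhds hx))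
    (by rw [minSmoothness_of_isRCLikeNormedField]; exact ENat.LEInfty.out),
    VectorField.mpullback_apply, mlieBracket_constField, map_zero]

theorem IsOrthogonalChart.isCommutingOrthogonalFamilyAt (h : IsOrthogonalChart g φ)
    (hx : x ∈ φ.source) : IsCommutingOrthogonalFamilyAt g (chartField E φ) x where
  vfDiffAt i := (contMDiffAt_chartField h.isSmoothChart i hx).mdifferentiableAt (by simp)
  mlieBracket_eq_zero i j := mlieBracket_chartField h.isSmoothChart i j hx
  orthogonal i j hij := by
    filter_upwards [φ.open_source.mem_nhds hx] with q hq
    have := h.orthogonal (φ q) (φ.map_source hq) i j hij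
    rwa [← chartField_symm h.isSmoothChart i (φ.map_source hq),
      ← chartField_symm h.isSmoothChart j (φ.map_source hq), φ.left_inv hq] at this

theorem contDiffOn_sqCoeff (hφ : IsSmoothChart (E := E) φ) (i : Fin n) :
    ContDiffOn ℝ ∞ (sqCoeff g φ i) φ.target := by
  rw [← contMDiffOn_iff_contDiffOn]
  have inner_smooth : ContMDiffOn 𝓘(ℝ, E) 𝓘(ℝ, ℝ) ∞
      (fun q => g.inner q (chartField E φ i q) (chartField E φ i q)) φ.source := fun q hq =>
    (contMDiffAt_inner (contMDiffAt_chartField hφ i hq)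
      (contMDiffAt_chartField hφ i hq)).contMDiffWithinAt
  exact (inner_smooth.comp hφ.smooth_symm φ.mapsTo_symm).congr (eqOn_sqCoeff hφ i)

theorem contDiffOn_coeff (hφ : IsSmoothChart (E := E) φ) (i : Fin n) :
    ContDiffOn ℝ ∞ (coeff g φ i) φ.target :=
  (contDiffOn_sqCoeff hφ i).sqrt fun _ hy => (sqCoeff_pos hφ i hy).ne'

theorem fderiv_sqCoeff_single (hφ : IsSmoothChart (E := E) φ) (i j : Fin n) {y : Coord n}
    (hy : y ∈ φ.target) :
    fderiv ℝ (sqCoeff g φ i) y (EuclideanSpace.single j 1) =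
      mvfderiv 𝓘(ℝ, E) (fun q => g.inner q (chartField E φ i q) (chartField E φ i q)) (φ.symm y)
        (chartField E φ j (φ.symm y)) := by
  have smooth := contMDiffAt_chartField hφ i (φ.map_target hy)
  have inner_diff : MDifferentiableAt 𝓘(ℝ, E) 𝓘(ℝ, ℝ)
      (fun q => g.inner q (chartField E φ i q) (chartField E φ i q)) (φ.symm y) :=
    (contMDiffAt_inner smooth smooth).mdifferentiableAt (by simp)
  rw [((eqOn_sqCoeff hφ i).eventuallyEq_of_mem (φ.open_target.mem_nhds hy)).fderiv_eq,
    ← mfderiv_eq_fderiv, mfderiv_comp y inner_diff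
      (hφ.mdifferentiable.mdifferentiableAt_symm hy), chartField_symm hφ j hy]
  rfl

end CoordinateFields

section Pairs

variable {m : ℕ}

/-- The coordinate indices, as first and second indices of the `m` pairs. -/
def pairIndexEquiv (m : ℕ) : Fin m ⊕ Fin m ≃ Fin (2 * m) :=
  Equiv.ofBijective (Sum.elim fstIdx sndIdx) <| by
    refine (Fintype.bijective_iff_injective_and_card _).2 ⟨?_, by simp [two_mul]⟩
    rintro (k | k) (l | l) h <;>
      simp only [Sum.elim_inl, Sum.elim_inr, fstIdx, sndIdx, Sum.inl.injEq,
        Sum.inr.injEq, Fin.ext_iff, reduceCtorEq] at h ⊢ <;> omega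

theorem pairIndexEquiv_symm_fstIdx (k : Fin m) :
    (pairIndexEquiv m).symm (fstIdx k) = Sum.inl k :=
  (pairIndexEquiv m).symm_apply_apply (Sum.inl k)

theorem pairIndexEquiv_symm_sndIdx (k : Fin m) :
    (pairIndexEquiv m).symm (sndIdx k) = Sum.inr k :=
  (pairIndexEquiv m).symm_apply_apply (Sum.inr k)

theorem forall_pairIndex_iff {P : Fin (2 * m) → Prop} :
    (∀ i, P i) ↔ ∀ k, P (fstIdx k) ∧ P (sndIdx k) := by
  refine ⟨fun h k => ⟨h _, h _⟩, fun h i => ?_⟩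
  obtain ⟨k | k, rfl⟩ := (pairIndexEquiv m).surjective i
  exacts [(h k).1, (h k).2]

/-- The pair that the `i`-th coordinate belongs to. -/
def pairIndex (i : Fin (2 * m)) : Fin m :=
  Sum.elim id id ((pairIndexEquiv m).symm i)

/-- The index of the other coordinate of the pair of `i`. -/
def partner (i : Fin (2 * m)) : Fin (2 * m) :=
  pairIndexEquiv m ((pairIndexEquiv m).symm i).swap

theorem partner_fstIdx (k : Fin m) : partner (fstIdx k) = sndIdx k := by
  rw [partner, pairIndexEquiv_symm_fstIdx]
  rfl

theorem partner_sndIdx (k : Fin m) : partner (sndIdx k) = fstIdx k := by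
  rw [partner, pairIndexEquiv_symm_sndIdx]
  rfl

theorem pairIndex_fstIdx (k : Fin m) : pairIndex (fstIdx k) = k := by
  rw [pairIndex, pairIndexEquiv_symm_fstIdx]
  rfl

theorem pairIndex_sndIdx (k : Fin m) : pairIndex (sndIdx k) = k := by
  rw [pairIndex, pairIndexEquiv_symm_sndIdx]
  rfl

theorem fstIdx_ne_sndIdx (k l : Fin m) : fstIdx k ≠ sndIdx l := fun h =>
  Sum.inl_ne_inr ((pairIndexEquiv m).injective h)

theorem fstIdx_inj {k l : Fin m} : fstIdx k = fstIdx l ↔ k = l :=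
  ((pairIndexEquiv m).injective.comp Sum.inl_injective).eq_iff

theorem sndIdx_inj {k l : Fin m} : sndIdx k = sndIdx l ↔ k = l :=
  ((pairIndexEquiv m).injective.comp Sum.inr_injective).eq_iff

theorem partner_partner (i : Fin (2 * m)) : partner (partner i) = i := by
  simp [partner]

theorem pairIndex_partner (i : Fin (2 * m)) : pairIndex (partner i) = pairIndex i := by
  revert i
  simp [forall_pairIndex_iff, partner_fstIdx, partner_sndIdx, pairIndex_fstIdx, pairIndex_sndIdx]

theorem partner_ne (i : Fin (2 * m)) : partner i ≠ i := by
  revert i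
  simp [forall_pairIndex_iff, partner_fstIdx, partner_sndIdx, fstIdx_ne_sndIdx,
    (fstIdx_ne_sndIdx _ _).symm]

/-- The identification of `ℝ²ᵐ` with `ℂᵐ` whose `k`-th complex coordinate is made of the `k`-th
pair of real coordinates. -/
def pairEquiv (m : ℕ) : Coord (2 * m) ≃L[ℝ] (Fin m → ℂ) :=
  LinearEquiv.toContinuousLinearEquiv
    { toFun := fun y k => ⟨y (fstIdx k), y (sndIdx k)⟩
      map_add' := fun _ _ => rfl
      map_smul' := fun _ _ => funext fun _ => by apply Complex.ext <;> simp
      invFun := fun z => WithLp.toLp 2 fun i =>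
        Sum.elim (fun k => (z k).re) (fun k => (z k).im) ((pairIndexEquiv m).symm i)
      left_inv := fun y => by
        ext i
        revert i
        simp [forall_pairIndex_iff, pairIndexEquiv_symm_fstIdx, pairIndexEquiv_symm_sndIdx]
      right_inv := fun z => by
        simp [pairIndexEquiv_symm_fstIdx, pairIndexEquiv_symm_sndIdx] }

theorem pairEquiv_apply (y : Coord (2 * m)) (k : Fin m) :
    pairEquiv m y k = ⟨y (fstIdx k), y (sndIdx k)⟩ := rfl

theorem pairEquiv_single_fstIdx (k : Fin m) :
    pairEquiv m (EuclideanSpace.single (fstIdx k) 1) = Pi.single k 1 := by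
  ext l
  apply Complex.ext <;>
    simp [pairEquiv_apply, Pi.single_apply, fstIdx_inj, (fstIdx_ne_sndIdx _ _).symm, apply_ite]

theorem pairEquiv_single_sndIdx (k : Fin m) :
    pairEquiv m (EuclideanSpace.single (sndIdx k) 1) = Pi.single k Complex.I := by
  ext l
  apply Complex.ext <;>
    simp [pairEquiv_apply, Pi.single_apply, sndIdx_inj, fstIdx_ne_sndIdx, apply_ite]

theorem pairEquiv_symm_single (k : Fin m) (v : ℂ) :
    (pairEquiv m).symm (Pi.single k v) =
      v.re • EuclideanSpace.single (fstIdx k) 1 + v.im • EuclideanSpace.single (sndIdx k) 1 := by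
  rw [ContinuousLinearEquiv.symm_apply_eq, map_add, map_smul, map_smul, pairEquiv_single_fstIdx,
    pairEquiv_single_sndIdx, ← Pi.single_smul, ← Pi.single_smul, ← Pi.single_add]
  simp

end Pairs

section DependsOnlyOnPair

variable {M : Type*} [TopologicalSpace M] {m : ℕ} {φ : OpenPartialHomeomorph M (Coord (2 * m))}

theorem dependsOnlyOnPair_of_fderiv_eq_zero {k : Fin m} {f : Coord (2 * m) → ℝ}
    (hf : DifferentiableOn ℝ f φ.target)
    (hf' : ∀ y ∈ φ.target, ∀ j, pairIndex j ≠ k →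
      fderiv ℝ f y (EuclideanSpace.single j 1) = 0) :
    DependsOnlyOnPair φ k f := by
  intro V hV hVφ y hy z hz hfst hsnd
  have segment_subset : segment ℝ y z ⊆ φ.target := (hV.segment_subset hy hz).trans hVφ
  refine eq_of_fderiv_sub_eq_zero
    (fun x hx => hf.differentiableAt (φ.open_target.mem_nhds (segment_subset hx)))
    fun x hx => ?_
  rw [← (EuclideanSpace.basisFun _ ℝ).sum_repr (z - y), map_sum]
  refine Finset.sum_eq_zero fun j _ => ?_
  rw [EuclideanSpace.basisFun_apply, map_smul]
  by_cases hj : pairIndex j = k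
  · have : z j = y j := by
      revert j
      simp +contextual [forall_pairIndex_iff, pairIndex_fstIdx, pairIndex_sndIdx, hfst, hsnd]
    simp [this]
  · rw [hf' x (segment_subset hx) j hj, smul_zero]

variable {E : Type*} [NormedAddCommGroup E] [NormedSpace ℂ E]
  [ChartedSpace E M] [IsManifold 𝓘(ℂ, E) ω M] {g : SmoothMetric E M}

theorem IsUnitaryOrthogonalChart.exists_complexJ_frame_partner (h : IsUnitaryOrthogonalChart g φ)
    (i : Fin (2 * m)) : ∃ ε : ℝ, ε ≠ 0 ∧ ∀ y ∈ φ.target,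
      complexJ (φ.symm y) (frame g φ (partner i) y) = ε • frame g φ i y := by
  revert i
  rw [forall_pairIndex_iff]
  refine fun k => ⟨⟨-1, by simp, fun y hy => ?_⟩, ⟨1, one_ne_zero, fun y hy => ?_⟩⟩
  · rw [partner_fstIdx, h.map_snd y hy, neg_one_smul]
  · rw [partner_sndIdx, h.map_fst y hy, one_smul]

theorem IsUnitaryOrthogonalChart.exists_complexJ_chartField_partner [CompleteSpace E]
    (h : IsUnitaryOrthogonalChart g φ) (i : Fin (2 * m)) :
    ∃ σ : M → ℝ, MDifferentiableOn 𝓘(ℝ, E) 𝓘(ℝ, ℝ) σ φ.source ∧ ∀ q ∈ φ.source, σ q ≠ 0 ∧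
      complexJ q (chartField E φ (partner i) q) = σ q • chartField E φ i q := by
  have s := h.isOrthogonalChart.isSmoothChart
  obtain ⟨ε, hε, hJ⟩ := h.exists_complexJ_frame_partner i
  let ratio : Coord (2 * m) → ℝ :=
    fun y => coeff g φ (partner i) y * (ε * (coeff g φ i y)⁻¹)
  have ratio_smooth : ContDiffOn ℝ ∞ ratio φ.target := (contDiffOn_coeff s _).mul
    (contDiffOn_const.mul ((contDiffOn_coeff s i).inv fun y hy => coeff_ne_zero s i hy))
  refine ⟨ratio ∘ φ, ?_, fun q hq => ⟨?_, ?_⟩⟩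
  · exact (ratio_smooth.contMDiffOn.mdifferentiableOn (by simp)).comp
      s.mdifferentiable.1 φ.mapsTo
  · have hφq := φ.map_source hq
    exact mul_ne_zero (coeff_ne_zero s _ hφq) (mul_ne_zero hε (inv_ne_zero (coeff_ne_zero s i hφq)))
  · obtain ⟨y, hy, rfl⟩ : ∃ y ∈ φ.target, φ.symm y = q := ⟨φ q, φ.map_source hq, φ.left_inv hq⟩
    rw [chartField_symm s _ hy, chartField_symm s _ hy, ← coeff_smul_frame (g := g) s _ hy,
      map_smul, hJ y hy, frame, smul_smul, smul_smul, mul_assoc, Function.comp_apply,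
      φ.right_inv hy]

theorem IsUnitaryOrthogonalChart.fderiv_sqCoeff_eq_zero [FiniteDimensional ℂ E]
    (h : IsUnitaryOrthogonalChart g φ) (hg : IsKahler g) {i j : Fin (2 * m)}
    (hij : pairIndex j ≠ pairIndex i) {y : Coord (2 * m)} (hy : y ∈ φ.target) :
    fderiv ℝ (sqCoeff g φ i) y (EuclideanSpace.single j 1) = 0 := by
  have : CompleteSpace E := FiniteDimensional.complete ℂ E
  have ho := h.isOrthogonalChart
  have hyφ := φ.map_target hy
  obtain ⟨σ, hσ, hj⟩ := h.exists_complexJ_chartField_partner j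
  obtain ⟨τ, -, hi⟩ := h.exists_complexJ_chartField_partner (partner i)
  rw [partner_partner] at hi
  rw [fderiv_sqCoeff_single ho.isSmoothChart i j hy]
  refine hg.mvfderiv_inner_self_eq_zero (ho.isCommutingOrthogonalFamilyAt hyφ)
    (i' := partner i) (j := partner j) (partner_ne i).symm ?_ ?_ ?_
    (hσ.mdifferentiableAt (φ.open_source.mem_nhds hyφ)) (hj _ hyφ).1
    (Filter.mem_of_superset (φ.open_source.mem_nhds hyφ) fun q hq => (hj q hq).2) (hi _ hyφ).2
  · rintro rfl
    exact hij (pairIndex_partner j).symm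
  · rintro rfl
    exact hij rfl
  · intro hpartner
    exact hij (by rw [← pairIndex_partner j, ← hpartner, pairIndex_partner])

theorem IsUnitaryOrthogonalChart.dependsOnlyOnPair_coeff [FiniteDimensional ℂ E]
    (h : IsUnitaryOrthogonalChart g φ) (hg : IsKahler g) (i : Fin (2 * m)) :
    DependsOnlyOnPair φ (pairIndex i) (coeff g φ i) := by
  have : CompleteSpace E := FiniteDimensional.complete ℂ E
  have sq : DependsOnlyOnPair φ (pairIndex i) (sqCoeff g φ i) :=
    dependsOnlyOnPair_of_fderiv_eq_zero
      ((contDiffOn_sqCoeff h.isOrthogonalChart.isSmoothChart i).differentiableOn (by simp))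
      fun y hy j hij => h.fderiv_sqCoeff_eq_zero hg hij hy
  exact fun V hV hVφ y hy z hz hfst hsnd => congrArg Real.sqrt (sq V hV hVφ y hy z hz hfst hsnd)

theorem IsUnitaryOrthogonalChart.dependsOnlyOnPair_coeff_fst [FiniteDimensional ℂ E]
    (h : IsUnitaryOrthogonalChart g φ) (hg : IsKahler g) (k : Fin m) :
    DependsOnlyOnPair φ k (coeff g φ (fstIdx k)) := by
  simpa only [pairIndex_fstIdx] using h.dependsOnlyOnPair_coeff hg (fstIdx k)

theorem IsUnitaryOrthogonalChart.dependsOnlyOnPair_coeff_snd [FiniteDimensional ℂ E]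
    (h : IsUnitaryOrthogonalChart g φ) (hg : IsKahler g) (k : Fin m) :
    DependsOnlyOnPair φ k (coeff g φ (sndIdx k)) := by
  simpa only [pairIndex_sndIdx] using h.dependsOnlyOnPair_coeff hg (sndIdx k)

end DependsOnlyOnPair

section Coframe

variable {E : Type*} [NormedAddCommGroup E] [NormedSpace ℂ E]
  {M : Type*} [TopologicalSpace M] [ChartedSpace E M] [IsManifold 𝓘(ℂ, E) ω M]
  {m : ℕ} {φ : OpenPartialHomeomorph M (Coord (2 * m))} {g : SmoothMetric E M} {y : Coord (2 * m)}

theorem sum_inner_pairEquiv (v w : Coord (2 * m)) :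
    ∑ k, inner ℝ (pairEquiv m v k) (pairEquiv m w k) = inner ℝ v w := by
  rw [PiLp.inner_apply, ← (pairIndexEquiv m).sum_comp, Fintype.sum_sum_type,
    ← Finset.sum_add_distrib]
  refine Finset.sum_congr rfl fun k _ => ?_
  simp [pairEquiv_apply, Complex.inner, pairIndexEquiv]

/-- The complex one-form `θ_k = a_{2k+1} dx_{2k+1} + i a_{2k+2} dx_{2k+2}`, at the point with
coordinates `y`. -/
def coframe (g : SmoothMetric E M) (φ : OpenPartialHomeomorph M (Coord (2 * m))) (k : Fin m)
    (y : Coord (2 * m)) : TangentSpace 𝓘(ℝ, E) (φ.symm y) →L[ℝ] ℂ :=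
  axisScale (coeff g φ (fstIdx k) y) (coeff g φ (sndIdx k) y) ∘L
    (ContinuousLinearMap.proj k : (Fin m → ℂ) →L[ℝ] ℂ) ∘L
    (pairEquiv m : Coord (2 * m) →L[ℝ] (Fin m → ℂ)) ∘L
    (mfderiv 𝓘(ℝ, E) 𝓘(ℝ, Coord (2 * m)) φ (φ.symm y) : E →L[ℝ] Coord (2 * m))

theorem coframe_frame (hφ : IsSmoothChart (E := E) φ) (hy : y ∈ φ.target) (k : Fin m)
    (i : Fin (2 * m)) :
    coframe g φ k y (frame g φ i y) = pairEquiv m (EuclideanSpace.single i 1) k := by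
  have coframe_coordField : coframe g φ k y (coordField E φ i y) =
      axisScale (coeff g φ (fstIdx k) y) (coeff g φ (sndIdx k) y)
        (pairEquiv m (EuclideanSpace.single i 1) k) :=
    congrArg (fun v => axisScale _ _ (pairEquiv m v k)) (hφ.mfderiv_coordField i hy)
  rw [frame, map_smul, coframe_coordField, inv_smul_eq_iff₀ (coeff_ne_zero hφ i hy)]
  revert i
  rw [forall_pairIndex_iff]
  refine fun l => ⟨fun _ => ?_, fun _ => ?_⟩
  · rw [pairEquiv_single_fstIdx]
    obtain rfl | hkl := eq_or_ne k l
    · simp [axisScale_one]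
    · simp [hkl]
  · rw [pairEquiv_single_sndIdx]
    obtain rfl | hkl := eq_or_ne k l
    · simp [axisScale_I]
    · simp [hkl]

theorem IsUnitaryOrthogonalChart.coframe_complexJ (h : IsUnitaryOrthogonalChart g φ)
    (hy : y ∈ φ.target) (k : Fin m) (v : TangentSpace 𝓘(ℝ, E) (φ.symm y)) :
    coframe g φ k y (complexJ (φ.symm y) v) = Complex.I * coframe g φ k y v := by
  have hφ := h.isOrthogonalChart.isSmoothChart
  suffices coframe g φ k y ∘L complexJ (φ.symm y) = Complex.I • coframe g φ k y from
    DFunLike.congr_fun this v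
  refine ext_frame (g := g) hφ hy (forall_pairIndex_iff.2 fun l => ⟨?_, ?_⟩)
  · change coframe g φ k y (complexJ _ _) = Complex.I * coframe g φ k y _
    rw [h.map_fst y hy, coframe_frame hφ hy, coframe_frame hφ hy, pairEquiv_single_sndIdx,
      pairEquiv_single_fstIdx]
    simp [Pi.single_apply]
  · change coframe g φ k y (complexJ _ _) = Complex.I * coframe g φ k y _
    rw [h.map_snd y hy, map_neg, coframe_frame hφ hy, coframe_frame hφ hy,
      pairEquiv_single_sndIdx, pairEquiv_single_fstIdx]
    obtain rfl | hkl := eq_or_ne k l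
    · simp
    · simp [hkl]

theorem IsOrthogonalChart.inner_eq_sum_coframe (h : IsOrthogonalChart g φ) (hy : y ∈ φ.target)
    (v w : TangentSpace 𝓘(ℝ, E) (φ.symm y)) :
    g.inner (φ.symm y) v w = ∑ k, inner ℝ (coframe g φ k y v) (coframe g φ k y w) := by
  have on_frame (i j : Fin (2 * m)) :
      g.inner (φ.symm y) (frame g φ i y) (frame g φ j y) =
        ∑ k, inner ℝ (coframe g φ k y (frame g φ i y)) (coframe g φ k y (frame g φ j y)) := by
    simp only [coframe_frame h.isSmoothChart hy]
    rw [h.inner_frame i j hy, sum_inner_pairEquiv]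
    simp [PiLp.inner_apply]
  let θ (k : Fin m) : E →L[ℝ] ℂ := coframe g φ k y
  let B : E →L[ℝ] E →L[ℝ] ℝ := ∑ k, (innerSL ℝ).bilinearComp (θ k) (θ k)
  have B_apply (v w : E) : B v w = ∑ k, inner ℝ (θ k v) (θ k w) := by
    simp only [B, sum_apply, ContinuousLinearMap.bilinearComp_apply, coe_innerSL_apply]
  have inner_eq : g.inner (φ.symm y) = B :=
    ext_frame (g := g) h.isSmoothChart hy fun i =>
      ext_frame (g := g) h.isSmoothChart hy fun j => (on_frame i j).trans (B_apply _ _).symm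
  rw [inner_eq]
  exact B_apply v w

end Coframe

section Slices

variable {m : ℕ} {M : Type*} [TopologicalSpace M]
  {φ : OpenPartialHomeomorph M (Coord (2 * m))} {y₀ : Coord (2 * m)} {k : Fin m}

/-- The point `y₀` with its `k`-th pair of coordinates replaced by `u`. -/
def slice (y₀ : Coord (2 * m)) (k : Fin m) (u : ℂ) : Coord (2 * m) :=
  (pairEquiv m).symm (Function.update (pairEquiv m y₀) k u)

theorem pairEquiv_slice (y₀ : Coord (2 * m)) (k : Fin m) (u : ℂ) :
    pairEquiv m (slice y₀ k u) = Function.update (pairEquiv m y₀) k u :=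
  (pairEquiv m).apply_symm_apply _

theorem slice_self (y₀ : Coord (2 * m)) (k : Fin m) : slice y₀ k (pairEquiv m y₀ k) = y₀ := by
  simp [slice]

theorem hasFDerivAt_slice (y₀ : Coord (2 * m)) (k : Fin m) (u : ℂ) :
    HasFDerivAt (slice y₀ k) ((pairEquiv m).symm ∘L
      ContinuousLinearMap.single ℝ (fun _ : Fin m => ℂ) k) u := by
  have update_deriv : HasFDerivAt (Function.update (pairEquiv m y₀) k)
      (ContinuousLinearMap.single ℝ (fun _ : Fin m => ℂ) k) u :=
    (hasFDerivAt_update (pairEquiv m y₀) u).congr_fderiv <| by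
      ext v l
      obtain rfl | hl := eq_or_ne l k
      · simp
      · simp [hl]
  exact (pairEquiv m).symm.hasFDerivAt.comp u update_deriv

theorem contDiff_slice (y₀ : Coord (2 * m)) (k : Fin m) {n : ℕ∞ω} :
    ContDiff ℝ n (slice y₀ k) :=
  (pairEquiv m).symm.contDiff.comp (contDiff_update n _ k)

theorem DependsOnlyOnPair.apply_slice {f : Coord (2 * m) → ℝ} (hf : DependsOnlyOnPair φ k f)
    {V : Set (Coord (2 * m))} (hV : Convex ℝ V) (hVφ : V ⊆ φ.target) {y : Coord (2 * m)}
    (hy : y ∈ V) (hslice : slice y₀ k (pairEquiv m y k) ∈ V) :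
    f (slice y₀ k (pairEquiv m y k)) = f y := by
  have pair_eq := congrFun (pairEquiv_slice y₀ k (pairEquiv m y k)) k
  rw [Function.update_self, pairEquiv_apply, pairEquiv_apply, Complex.mk.injEq] at pair_eq
  exact hf V hV hVφ _ hslice _ hy pair_eq.1 pair_eq.2

end Slices

section Factors

variable {E : Type*} [NormedAddCommGroup E] [NormedSpace ℂ E]
  {M : Type*} [TopologicalSpace M] [ChartedSpace E M] [IsManifold 𝓘(ℂ, E) ω M]

theorem exists_holomorphic_mfderiv_ne_zero (p : M) {v : TangentSpace 𝓘(ℝ, E) p} (hv : v ≠ 0) :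
    ∃ (f : M → ℂ) (N : Set M), IsOpen N ∧ p ∈ N ∧ MDifferentiableOn 𝓘(ℂ, E) 𝓘(ℂ, ℂ) f N ∧
      ContMDiffOn 𝓘(ℝ, E) 𝓘(ℝ, ℂ) ∞ f N ∧ mfderiv 𝓘(ℝ, E) 𝓘(ℝ, ℂ) f p v ≠ 0 := by
  have hp := mem_chart_source E p
  have chart_deriv := mdifferentiable_chart (I := 𝓘(ℝ, E)) p
  let w : E := mfderiv 𝓘(ℝ, E) 𝓘(ℝ, E) (chartAt E p) p v
  have hw : w ≠ 0 := (map_ne_zero_iff _ (chart_deriv.mfderiv_injective hp)).2 hv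
  obtain ⟨ℓ, hℓ⟩ := SeparatingDual.exists_ne_zero (R := ℂ) hw
  refine ⟨ℓ ∘ chartAt E p, (chartAt E p).source, (chartAt E p).open_source, hp, ?_, ?_, ?_⟩
  · exact ℓ.differentiable.mdifferentiable.comp_mdifferentiableOn
      (mdifferentiable_chart (I := 𝓘(ℂ, E)) p).1
  · exact (ℓ.restrictScalars ℝ).contMDiff.comp_contMDiffOn (contMDiffOn_chart (I := 𝓘(ℝ, E)))
  · have chain := (ℓ.restrictScalars ℝ).hasMFDerivAt.comp p
      (chart_deriv.mdifferentiableAt hp).hasMFDerivAt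
    exact fun h0 => hℓ ((DFunLike.congr_fun chain.mfderiv v).symm.trans h0)

variable {m : ℕ} {φ : OpenPartialHomeomorph M (Coord (2 * m))} {g : SmoothMetric E M}
  {y y₀ : Coord (2 * m)}

theorem IsUnitaryOrthogonalChart.mfderiv_symm_pairEquiv_symm_single
    (h : IsUnitaryOrthogonalChart g φ) (hy : y ∈ φ.target) (k : Fin m) (v : ℂ) :
    mfderiv 𝓘(ℝ, Coord (2 * m)) 𝓘(ℝ, E) φ.symm y ((pairEquiv m).symm (Pi.single k v)) =
      (v.re * coeff g φ (fstIdx k) y) • frame g φ (fstIdx k) y +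
        (v.im * coeff g φ (sndIdx k) y) • complexJ (φ.symm y) (frame g φ (fstIdx k) y) := by
  have hφ := h.isOrthogonalChart.isSmoothChart
  rw [h.map_fst y hy, mul_smul, mul_smul, coeff_smul_frame hφ _ hy, coeff_smul_frame hφ _ hy,
    pairEquiv_symm_single]
  let L : Coord (2 * m) →L[ℝ] E := mfderiv 𝓘(ℝ, Coord (2 * m)) 𝓘(ℝ, E) φ.symm y
  exact (map_add L _ _).trans (congrArg₂ (· + ·) (map_smul L _ _) (map_smul L _ _))

theorem IsUnitaryOrthogonalChart.fderiv_comp_slice (h : IsUnitaryOrthogonalChart g φ) {f : M → ℂ}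
    {k : Fin m} {u c : ℂ} (hu : slice y₀ k u ∈ φ.target)
    (hf : MDifferentiableAt 𝓘(ℂ, E) 𝓘(ℂ, ℂ) f (φ.symm (slice y₀ k u)))
    (hc : mfderiv 𝓘(ℝ, E) 𝓘(ℝ, ℂ) f (φ.symm (slice y₀ k u))
      (frame g φ (fstIdx k) (slice y₀ k u)) = c) :
    fderiv ℝ (f ∘ φ.symm ∘ slice y₀ k) u =
      c • axisScale (coeff g φ (fstIdx k) (slice y₀ k u))
        (coeff g φ (sndIdx k) (slice y₀ k u)) := by
  have symm_diff :=
    h.isOrthogonalChart.isSmoothChart.mdifferentiable.mdifferentiableAt_symm hu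
  have f_diff : MDifferentiableAt 𝓘(ℝ, E) 𝓘(ℝ, ℂ) f (φ.symm (slice y₀ k u)) :=
    (hasMFDerivAt_real_of_complex hf.hasMFDerivAt).mdifferentiableAt
  have chain := f_diff.hasMFDerivAt.comp u
    (symm_diff.hasMFDerivAt.comp u (hasFDerivAt_slice y₀ k u).hasMFDerivAt)
  ext v
  rw [← mfderiv_eq_fderiv]
  refine (DFunLike.congr_fun chain.mfderiv v).trans ?_
  change mfderiv 𝓘(ℝ, E) 𝓘(ℝ, ℂ) f _ (mfderiv 𝓘(ℝ, Coord (2 * m)) 𝓘(ℝ, E) φ.symm _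
    ((pairEquiv m).symm (Pi.single k v))) = c * axisScale _ _ v
  rw [h.mfderiv_symm_pairEquiv_symm_single hu, map_add, map_smul, map_smul, mfderiv_complexJ hf,
    hc, axisScale_apply]
  change (_ : ℝ) • c + (_ : ℝ) • (Complex.I • c) = _
  rw [Complex.real_smul, Complex.real_smul, smul_eq_mul, Complex.mk_eq_add_mul_I]
  push_cast
  ring

theorem IsUnitaryOrthogonalChart.exists_isIsothermalParametrization_of_holomorphic
    [CompleteSpace E] (h : IsUnitaryOrthogonalChart g φ) {k : Fin m} {O : Set ℂ} (hO : IsOpen O)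
    (hOφ : Set.MapsTo (slice y₀ k) O φ.target) (hy₀O : pairEquiv m y₀ k ∈ O)
    {f : M → ℂ} {N : Set M} (hN : IsOpen N) (f_holo : MDifferentiableOn 𝓘(ℂ, E) 𝓘(ℂ, ℂ) f N)
    (f_smooth : ContMDiffOn 𝓘(ℝ, E) 𝓘(ℝ, ℂ) ∞ f N)
    (hON : Set.MapsTo (φ.symm ∘ slice y₀ k) O N)
    (hf : mfderiv 𝓘(ℝ, E) 𝓘(ℝ, ℂ) f (φ.symm y₀) (frame g φ (fstIdx k) y₀) ≠ 0) :
    ∃ (S : MetricRiemannSurface) (e : OpenPartialHomeomorph ℂ S.carrier),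
      pairEquiv m y₀ k ∈ e.source ∧ e.source ⊆ O ∧
        IsIsothermalParametrization S e (coeff g φ (fstIdx k) ∘ slice y₀ k)
          (coeff g φ (sndIdx k) ∘ slice y₀ k) := by
  have hφ := h.isOrthogonalChart.isSmoothChart
  have slice_smooth := (contDiff_slice y₀ k (n := ∞)).contDiffOn (s := O)
  have W_smooth : ContDiffOn ℝ ∞ (f ∘ φ.symm ∘ slice y₀ k) O := contMDiffOn_iff_contDiffOn.1 <|
    f_smooth.comp (hφ.smooth_symm.comp slice_smooth.contMDiffOn hOφ) hON
  have fderiv_W (u) (hu : u ∈ O) := h.fderiv_comp_slice (hOφ hu)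
    (f_holo.mdifferentiableAt (hN.mem_nhds (hON hu))) rfl
  have df_frame_ne : ∀ y, y = y₀ →
      mfderiv 𝓘(ℝ, E) 𝓘(ℝ, ℂ) f (φ.symm y) (frame g φ (fstIdx k) y) ≠ 0 := by
    rintro _ rfl
    exact hf
  refine exists_isIsothermalParametrization hO W_smooth
    ((contDiffOn_coeff hφ _).comp slice_smooth hOφ)
    (fun u hu => coeff_ne_zero hφ _ (hOφ hu)) (fun u hu => coeff_ne_zero hφ _ (hOφ hu))
    (fun u hu => ⟨_, fderiv_W u hu⟩) hy₀O ?_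
  rw [fderiv_W _ hy₀O]
  exact smul_ne_zero (df_frame_ne _ (slice_self y₀ k))
    (axisScale_ne_zero (coeff_ne_zero hφ _ (hOφ hy₀O)))

theorem IsUnitaryOrthogonalChart.exists_isIsothermalParametrization_slice [CompleteSpace E]
    (h : IsUnitaryOrthogonalChart g φ) {k : Fin m} {O : Set ℂ} (hO : IsOpen O)
    (hOφ : Set.MapsTo (slice y₀ k) O φ.target) (hy₀O : pairEquiv m y₀ k ∈ O) :
    ∃ (S : MetricRiemannSurface) (e : OpenPartialHomeomorph ℂ S.carrier),
      pairEquiv m y₀ k ∈ e.source ∧ e.source ⊆ O ∧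
        IsIsothermalParametrization S e (coeff g φ (fstIdx k) ∘ slice y₀ k)
          (coeff g φ (sndIdx k) ∘ slice y₀ k) := by
  have hφ := h.isOrthogonalChart.isSmoothChart
  have hy₀ : y₀ ∈ φ.target := slice_self y₀ k ▸ hOφ hy₀O
  have frame_ne : frame g φ (fstIdx k) y₀ ≠ 0 :=
    smul_ne_zero (inv_ne_zero (coeff_ne_zero hφ _ hy₀)) (coordField_ne_zero hφ _ hy₀)
  obtain ⟨f, N, hN, mem_N, f_holo, f_smooth, hf⟩ :=
    exists_holomorphic_mfderiv_ne_zero (φ.symm y₀) frame_ne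
  let O' := O ∩ (φ.symm ∘ slice y₀ k) ⁻¹' N
  have hO' : IsOpen O' := ContinuousOn.isOpen_inter_preimage
    (φ.continuousOn_symm.comp (contDiff_slice y₀ k (n := 0)).continuous.continuousOn hOφ) hO hN
  have hy₀O' : pairEquiv m y₀ k ∈ O' :=
    ⟨hy₀O, by rwa [Set.mem_preimage, Function.comp_apply, slice_self]⟩
  obtain ⟨S, e, hy₀e, source_subset, he⟩ := h.exists_isIsothermalParametrization_of_holomorphic hO'
    (hOφ.mono_left Set.inter_subset_left) hy₀O' hN f_holo f_smooth (fun u hu => hu.2) hf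
  exact ⟨S, e, hy₀e, source_subset.trans Set.inter_subset_left, he⟩

end Factors

section ProductChart

variable {E : Type*} [NormedAddCommGroup E] [NormedSpace ℂ E]
  {M : Type*} [TopologicalSpace M] [ChartedSpace E M]
  {m : ℕ} {φ : OpenPartialHomeomorph M (Coord (2 * m))} {S : Fin m → MetricRiemannSurface}
  {e : ∀ k, OpenPartialHomeomorph ℂ (S k).carrier}

/-- The chart `φ` followed by the parametrizations `e k` of the surfaces `S k`, the `k`-th one
being applied to the `k`-th pair of coordinates. -/
def productChart (φ : OpenPartialHomeomorph M (Coord (2 * m)))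
    (e : ∀ k, OpenPartialHomeomorph ℂ (S k).carrier) :
    OpenPartialHomeomorph M (Π k, (S k).carrier) :=
  (φ.transHomeomorph (pairEquiv m).toHomeomorph).trans (OpenPartialHomeomorph.pi e)

theorem mem_productChart_source {q : M} :
    q ∈ (productChart φ e).source ↔
      q ∈ φ.source ∧ ∀ k, pairEquiv m (φ q) k ∈ (e k).source := by
  simp [productChart]

theorem productChart_target (he : ∀ k, (e k).target = Set.univ)
    (heφ : ∀ z : Fin m → ℂ, (∀ k, z k ∈ (e k).source) → (pairEquiv m).symm z ∈ φ.target) :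
    (productChart φ e).target = Set.univ := by
  have mem_target (w : Π k, (S k).carrier) (k : Fin m) : w k ∈ (e k).target := by
    rw [he k]
    exact Set.mem_univ _
  exact Set.eq_univ_of_forall fun w =>
    ⟨fun k _ => mem_target w k, heφ _ fun k => (e k).map_target (mem_target w k)⟩

variable [IsManifold 𝓘(ℂ, E) ω M] {g : SmoothMetric E M} {y : Coord (2 * m)}

theorem IsIsothermalParametrization.exists_hasMFDerivAt_comp_chart {S : MetricRiemannSurface}
    {e : OpenPartialHomeomorph ℂ S.carrier} {α β : ℂ → ℝ} (he : IsIsothermalParametrization S e α β)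
    (hφ : IsSmoothChart (E := E) φ) (hy : y ∈ φ.target) {k : Fin m}
    (hu : pairEquiv m y k ∈ e.source)
    (hα : α (pairEquiv m y k) = coeff g φ (fstIdx k) y)
    (hβ : β (pairEquiv m y k) = coeff g φ (sndIdx k) y) :
    ∃ c : ℂ, HasMFDerivAt 𝓘(ℝ, E) 𝓘(ℝ, ℂ) (fun q => e (pairEquiv m (φ q) k)) (φ.symm y)
        (c • coframe g φ k y) ∧
      ∀ z w : ℂ, S.metric.inner (e (pairEquiv m (φ (φ.symm y)) k)) (c * z : ℂ) (c * w : ℂ) =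
        inner ℝ z w := by
  have right_inv := φ.right_inv hy
  obtain ⟨c, hc, inner_mul⟩ := he.exists_hasMFDerivAt (pairEquiv m (φ (φ.symm y)) k)
    (right_inv.symm ▸ hu)
  rw [show α (pairEquiv m (φ (φ.symm y)) k) = _ by rw [right_inv, hα],
    show β (pairEquiv m (φ (φ.symm y)) k) = _ by rw [right_inv, hβ]] at hc
  have φ_deriv := (hφ.mdifferentiable.mdifferentiableAt (φ.map_target hy)).hasMFDerivAt
  have pair_deriv := ((ContinuousLinearMap.proj k : (Fin m → ℂ) →L[ℝ] ℂ) ∘L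
    (pairEquiv m : Coord (2 * m) →L[ℝ] (Fin m → ℂ))).hasMFDerivAt (x := φ (φ.symm y))
  exact ⟨c, HasMFDerivAt.comp (φ.symm y) (g := e) hc (pair_deriv.comp (φ.symm y) φ_deriv),
    inner_mul⟩

theorem IsUnitaryOrthogonalChart.isProductIsometry_productChart
    (h : IsUnitaryOrthogonalChart g φ) {α β : Fin m → ℂ → ℝ}
    (he : ∀ k, IsIsothermalParametrization (S k) (e k) (α k) (β k))
    (heφ : ∀ z : Fin m → ℂ, (∀ k, z k ∈ (e k).source) → (pairEquiv m).symm z ∈ φ.target)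
    (hcoeff : ∀ y, (∀ k, pairEquiv m y k ∈ (e k).source) → ∀ k,
      α k (pairEquiv m y k) = coeff g φ (fstIdx k) y ∧
        β k (pairEquiv m y k) = coeff g φ (sndIdx k) y) :
    IsProductIsometry g S (productChart φ e) := by
  have deriv : ∀ q ∈ (productChart φ e).source, ∃ y ∈ φ.target, φ.symm y = q ∧
      ∀ k, ∃ c : ℂ, HasMFDerivAt 𝓘(ℝ, E) 𝓘(ℝ, ℂ) (fun q => productChart φ e q k) (φ.symm y)
        (c • coframe g φ k y) ∧ ∀ z w : ℂ,
          (S k).metric.inner (productChart φ e (φ.symm y) k) (c * z : ℂ) (c * w : ℂ) =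
            inner ℝ z w := by
    intro q hq
    obtain ⟨hqφ, hqe⟩ := mem_productChart_source.1 hq
    exact ⟨φ q, φ.map_source hqφ, φ.left_inv hqφ, fun k =>
      (he k).exists_hasMFDerivAt_comp_chart h.isOrthogonalChart.isSmoothChart (φ.map_source hqφ)
        (hqe k) (hcoeff _ hqe k).1 (hcoeff _ hqe k).2⟩
  refine ⟨productChart_target (fun k => (he k).target_eq) heφ, fun k q hq => ?_,
    fun q hq v w => ?_⟩
  · obtain ⟨y, hy, rfl, hderiv⟩ := deriv q hq
    obtain ⟨c, hc, -⟩ := hderiv k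
    refine (mdifferentiableAt_complex_of_map_I_smul hc fun v => ?_).mdifferentiableWithinAt
    exact (congrArg (c * ·) (h.coframe_complexJ hy k v)).trans (mul_left_comm _ _ _)
  · obtain ⟨y, hy, rfl, hderiv⟩ := deriv q hq
    rw [h.isOrthogonalChart.inner_eq_sum_coframe hy]
    refine Finset.sum_congr rfl fun k _ => ?_
    obtain ⟨c, hc, inner_mul⟩ := hderiv k
    rw [hc.mfderiv]
    exact (inner_mul _ _).symm

end ProductChart

section LocalProduct

variable {E : Type*} [NormedAddCommGroup E] [NormedSpace ℂ E] [FiniteDimensional ℂ E]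
  {M : Type*} [TopologicalSpace M] [ChartedSpace E M] [IsManifold 𝓘(ℂ, E) ω M]
  {m : ℕ} {φ : OpenPartialHomeomorph M (Coord (2 * m))} {g : SmoothMetric E M} {p : M}

/-- The product of the discs of radius `r` around the pairs of coordinates of `y₀`. -/
def polydisc (y₀ : Coord (2 * m)) (r : ℝ) : Set (Coord (2 * m)) :=
  pairEquiv m ⁻¹' Metric.ball (pairEquiv m y₀) r

theorem mem_polydisc {y₀ y : Coord (2 * m)} {r : ℝ} (hr : 0 < r) :
    y ∈ polydisc y₀ r ↔ ∀ k, pairEquiv m y k ∈ Metric.ball (pairEquiv m y₀ k) r :=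
  dist_pi_lt_iff hr

theorem convex_polydisc (y₀ : Coord (2 * m)) (r : ℝ) : Convex ℝ (polydisc y₀ r) :=
  (convex_ball _ _).linear_preimage (pairEquiv m).toLinearMap

theorem slice_mem_polydisc {y₀ : Coord (2 * m)} {r : ℝ} (hr : 0 < r) {k : Fin m} {u : ℂ}
    (hu : u ∈ Metric.ball (pairEquiv m y₀ k) r) : slice y₀ k u ∈ polydisc y₀ r := by
  rw [mem_polydisc hr, pairEquiv_slice,
    Function.forall_update_iff _ fun l z => z ∈ Metric.ball (pairEquiv m y₀ l) r]
  exact ⟨hu, fun l _ => Metric.mem_ball_self hr⟩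

theorem exists_polydisc_subset {y₀ : Coord (2 * m)} {s : Set (Coord (2 * m))} (hs : s ∈ 𝓝 y₀) :
    ∃ r > 0, polydisc y₀ r ⊆ s :=
  (((pairEquiv m).toHomeomorph.isInducing.basis_nhds Metric.nhds_basis_ball).mem_iff).1 hs

theorem IsUnitaryOrthogonalChart.exists_isProductIsometry (h : IsUnitaryOrthogonalChart g φ)
    (hg : IsKahler g) (hp : p ∈ φ.source) :
    ∃ (S : Fin m → MetricRiemannSurface) (Φ : OpenPartialHomeomorph M (Π k, (S k).carrier)),
      p ∈ Φ.source ∧ IsProductIsometry g S Φ := by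
  have : CompleteSpace E := FiniteDimensional.complete ℂ E
  obtain ⟨r, hr, polydisc_subset⟩ :=
    exists_polydisc_subset (φ.open_target.mem_nhds (φ.map_source hp))
  have factor (k : Fin m) := h.exists_isIsothermalParametrization_slice
    (Metric.isOpen_ball (x := pairEquiv m (φ p) k) (ε := r))
    (fun u hu => polydisc_subset (slice_mem_polydisc hr hu)) (Metric.mem_ball_self hr)
  choose S e hpe source_subset he using factor
  refine ⟨S, productChart φ e, mem_productChart_source.2 ⟨hp, hpe⟩,
    h.isProductIsometry_productChart he (fun z hz => polydisc_subset ?_) fun y hy k => ?_⟩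
  · exact (mem_polydisc hr).2 fun k => by
      rw [(pairEquiv m).apply_symm_apply]
      exact source_subset k (hz k)
  · have hyr : y ∈ polydisc (φ p) r := (mem_polydisc hr).2 fun k => source_subset k (hy k)
    have slice_mem := slice_mem_polydisc hr (source_subset k (hy k))
    have apply_slice (i) (hi : DependsOnlyOnPair φ k (coeff g φ i)) :=
      hi.apply_slice (convex_polydisc (φ p) r) polydisc_subset hyr slice_mem
    exact ⟨apply_slice _ (h.dependsOnlyOnPair_coeff_fst hg k),
      apply_slice _ (h.dependsOnlyOnPair_coeff_snd hg k)⟩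

end LocalProduct

end KahlerOrthogonal

end

open KahlerOrthogonal in
theorem mainTheorem3_general {m : ℕ} {E : Type*} [NormedAddCommGroup E] [NormedSpace ℂ E]
    [FiniteDimensional ℂ E] {M : Type*} [TopologicalSpace M] [ChartedSpace E M]
    [IsManifold 𝓘(ℂ, E) ω M] {g : SmoothMetric E M} (hg : IsKahler g)
    {φ : OpenPartialHomeomorph M (Coord (2 * m))} (hφ : IsUnitaryOrthogonalChart g φ) :
    (∀ k : Fin m, DependsOnlyOnPair φ k (coeff g φ (fstIdx k)) ∧
      DependsOnlyOnPair φ k (coeff g φ (sndIdx k))) ∧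
    ∀ p ∈ φ.source, ∃ (S : Fin m → MetricRiemannSurface)
      (Φ : OpenPartialHomeomorph M (Π k, (S k).carrier)), p ∈ Φ.source ∧ IsProductIsometry g S Φ :=
  ⟨fun k => ⟨hφ.dependsOnlyOnPair_coeff_fst hg k, hφ.dependsOnlyOnPair_coeff_snd hg k⟩,
    fun _ hp => hφ.exists_isProductIsometry hg hp⟩

open KahlerOrthogonal in
theorem mainTheorem3 {m : ℕ} {E : Type*} [NormedAddCommGroup E] [NormedSpace ℂ E]
    [FiniteDimensional ℂ E] (hE : Module.finrank ℂ E = m)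
    {M : Type*} [TopologicalSpace M] [T2Space M] [ChartedSpace E M] [IsManifold 𝓘(ℂ, E) ω M]
    (g : SmoothMetric E M) (hg : IsKahler g) :
    (∀ φ : OpenPartialHomeomorph M (Coord (2 * m)), IsUnitaryOrthogonalChart g φ →
      ∀ k : Fin m, DependsOnlyOnPair φ k (coeff g φ (fstIdx k)) ∧
        DependsOnlyOnPair φ k (coeff g φ (sndIdx k))) ∧
    (SupportsUnitaryOrthogonalCoordinates m g → IsLocallyProductOfRiemannSurfaces m g) :=
  ⟨fun _ hφ => (mainTheorem3_general hg hφ).1,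
    fun h p => let ⟨_, hp, hφ⟩ := h p; (mainTheorem3_general hg hφ).2 p hp⟩
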